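/- Let $K$ be a finite connected regular CW-complex of dimension at most $2$, let $\mathcal X(K)$ be its face poset (cells ordered by $e\le e'$ iff $e\subseteq\overline{e'}$), and let $M$ be an acyclic matching in $\mathcal X(K)$: a set of pairs $(e,e')$ with $e\prec e'$ such that each cell lies in at most one pair and the Hasse diagram of $\mathcal X(K)$ with the edges of $M$ reversed has no directed cycle. Cells in no pair of $M$ are called critical; assume that exactly one $0$-cell is critical. Presentations have a set of generators and a family of relators, which are elements of the free group on the generators (repeated and trivial relators are kept). *Standard presentation.* Let $L$ be a CW-complex of dimension at most $2$ whose 1-cells are oriented by their characteristic maps, and let $T$ be a spanning tree of $L^{(1)}$. A standard presentation $\mathcal P_L$ has the 1-cells outside $T$ as generators and one relator for each 2-cell $e$: choose a base point and a direction on the boundary of the disc, and an edge path in $L^{(1)}$ that is homotopic in $L^{(1)}$, relative to the base point, to the resulting attaching loop of $e$; the relator is the word of this edge path with the letters from $T$ deleted. *Morse presentation.* Let $T$ be the set of 1-cells of $K$ matched with 0-cells, and let $(x_1,e_1),\dots,(x_m,e_m)$ be the pairs of $M$ of dimensions $(1,2)$, in any order. For every 2-cell $e$ of $K$ choose a base vertex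 and a direction on its boundary, and let $w_e$ be the word of oriented 1-cells traversed by its attaching map. Let $\mathcal Q_0$ be the presentation with generators the 1-cells not in $T$ and one relator for each 2-cell $e$, namely $w_e$ with the letters from $T$ deleted. Given $\mathcal Q_{i-1}$, in which the relator of $e_i$ can be written $u\,x_i^{\epsilon}\,v$ with $\epsilon=\pm1$ and $x_i$ in neither $u$ nor $v$, obtain $\mathcal Q_{i}$ by removing the generator $x_i$ and the relator of $e_i$ and replacing $x_i$ by $(u^{-1}v^{-1})^{\epsilon}$ in all other relators. Put $\mathcal Q_{K,M}=\mathcal Q_m$. *Morse complex.* A Morse complex $K_M$ is a CW-complex obtained as follows, together with a deformation map $f:K\to K_M$. Order the cells of $K$ compatibly with the face relation (if $e$ is a proper face of $e'$ and $(e,e')\notin M$ then $e$ comes strictly before $e'$), the two cells of each pair of $M$ being placed at the same position and all other cells at distinct positions, and add the cells of $K$ in this order. When a critical cell $e$ with attaching map $\varphi$ is added, a cell $\tilde e$ with attaching map $f\varphi$ is attached to the complex built so far, and $f$ is extended over $e$ by carrying the characteristic map of $e$ to that of $\tilde e$. When a pair $(a,b)\in M$ is added to the subcomplex $L$ of previous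 cells, $f$ is extended to $L\cup a\cup b$ as $f\circ r$, where $r:L\cup a\cup b\to L$ is a retraction with $r(\overline b)\subseteq\overline b$ (a retraction of the elementary collapse $L\cup a\cup b\searrow L$). The cells of $K_M$ are thus the cells $\tilde e$, for $e$ a critical cell of $K$. **Proposition.** $T$ is the edge set of a spanning tree of $K^{(1)}$. For every choice of base vertices and directions on the 2-cells of $K$, the procedure above is well defined and its result $\mathcal Q_{K,M}$ does not depend on the order of the pairs $(x_i,e_i)$. Its generators are the critical 1-cells and its relators are labelled by the critical 2-cells. For every Morse complex $K_M$, under the correspondence $e\leftrightarrow\tilde e$ of cells, $$\mathcal Q_{K,M}=\mathcal P_{K_M}$$ for a suitable choice of orientations and base points in $K_M$: the 1-cells of $K_M$ carry the orientations induced from $K$, and the presentations have the same generators and, for each critical 2-cell, the same relator in the free group. -/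

import Mathlib

open Set Metric Topology Topology.CWComplex

noncomputable section

namespace MorsePresentation

/-! ## Group presentations -/

/-- A group presentation. The generators form a subset of `G`; the relators form a family, indexed
by a subset of `R`, of elements of the free group on the generators (words up to free reduction).
Repeated and trivial relators are kept. -/
@[ext]
structure GroupPresentation (G R : Type*) where
  /-- The set of generators. -/
  gens : Set G
  /-- The labels of the relators. -/
  labels : Set R
  /-- The relator with a given label. -/
  rel : labels → FreeGroup gens

namespace GroupPresentation

variable {G R G' R' : Type*}

/-- Words in the generators of `P` other than `x`, seen as words in the generators of `P`. -/
def incl (P : GroupPresentation G R) (x : G) :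
    FreeGroup ↥(P.gens \ {x}) →* FreeGroup P.gens :=
  FreeGroup.map (fun g => ⟨g.1, g.2.1⟩)

/-- The rewriting rule. The relator with label `e` is `w₁ x ^ ε w₂` with `ε = ±1`, where the
generator `x` appears neither in `w₁` nor in `w₂`, and `u = (w₁⁻¹ w₂⁻¹) ^ ε` is the equivalent
expression of `x` induced by this relator. -/
def IsEquivalentExpression (P : GroupPresentation G R) (x : P.gens) (e : P.labels)
    (u : FreeGroup ↥(P.gens \ {x.1})) : Prop :=
  ∃ (w₁ w₂ : FreeGroup ↥(P.gens \ {x.1})) (ε : ℤ), (ε = 1 ∨ ε = -1) ∧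
    P.rel e = P.incl x.1 w₁ * FreeGroup.of x ^ ε * P.incl x.1 w₂ ∧
    u = (w₁⁻¹ * w₂⁻¹) ^ ε

open Classical in
/-- Remove the generator `x` and the relator with label `e`, and replace every occurrence of `x`
in the remaining relators by `u`. -/
def eliminate (P : GroupPresentation G R) (x : P.gens) (e : P.labels)
    (u : FreeGroup ↥(P.gens \ {x.1})) : GroupPresentation G R where
  gens := P.gens \ {x.1}
  labels := P.labels \ {e.1}
  rel f := FreeGroup.lift
    (fun g : P.gens => if h : g.1 = x.1 then u else FreeGroup.of ⟨g.1, g.2, h⟩)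
    (P.rel ⟨f.1, f.2.1⟩)

/-- `P.ReducesTo l Q`: the presentation `Q` is obtained from `P` by processing the pairs `(x, e)`
of the list `l` in order; each of them removes the relator with label `e` and the generator `x`
(which must appear exactly once in that relator) and applies the rewriting rule to the rest. -/
inductive ReducesTo : GroupPresentation G R → List (G × R) → GroupPresentation G R → Prop
  | nil (P : GroupPresentation G R) : ReducesTo P [] P
  | cons (P Q : GroupPresentation G R) (x : P.gens) (e : P.labels)
      (u : FreeGroup ↥(P.gens \ {x.1})) (l : List (G × R))
      (hu : P.IsEquivalentExpression x e u) (hQ : ReducesTo (P.eliminate x e u) l Q) :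
      ReducesTo P ((x.1, e.1) :: l) Q

/-- `P` and `Q` are equal after renaming generators and labels of relators along `α` and `β`. -/
def EqVia (P : GroupPresentation G R) (Q : GroupPresentation G' R')
    (α : P.gens ≃ Q.gens) (β : P.labels ≃ Q.labels) : Prop :=
  ∀ e, FreeGroup.map α (P.rel e) = Q.rel (β e)

end GroupPresentation

/-! ## Edge paths and standard presentations of CW complexes -/

section Complexes

variable {X : Type*} [TopologicalSpace X] (C : Set X) [CWComplex C]

/-- An oriented 1-cell; `(x, true)` is `x` traversed in the direction of its characteristic map
`[-1, 1] → X`, and `(x, false)` is `x` traversed in the opposite direction. -/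
abbrev OrientedEdge := cell C 1 × Bool

/-- `IsEdgePath C l γ`: the path `γ` is the concatenation of the oriented 1-cells in `l`, traversed
one after the other; constant paths at 0-cells have the empty word. -/
inductive IsEdgePath : List (OrientedEdge C) → ∀ {a b : X}, Path a b → Prop
  | const (v : cell C 0) : IsEdgePath [] (Path.refl (map 0 v ![]))
  | edge (x : cell C 1) (ε : Bool) {a b : X} (γ : Path a b)
      (h : ∀ t : unitInterval, γ t =
        map 1 x (fun _ => if ε then 2 * (t : ℝ) - 1 else 1 - 2 * (t : ℝ))) :
      IsEdgePath [(x, ε)] γ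
  | append {l₁ l₂ : List (OrientedEdge C)} {a b c : X} {γ₁ : Path a b} {γ₂ : Path b c}
      (h₁ : IsEdgePath l₁ γ₁) (h₂ : IsEdgePath l₂ γ₂) : IsEdgePath (l₁ ++ l₂) (γ₁.trans γ₂)

/-- `γ` is the attaching map of the 2-cell `e`, seen as a loop: the boundary of the disc is
traversed once, from some base point and in one of the two directions. -/
def IsAttachingLoop (e : cell C 2) {a : X} (γ : Path a a) : Prop :=
  ∃ c : unitInterval → (Fin 2 → ℝ), Continuous c ∧ c 0 = c 1 ∧
    BijOn c (Iio 1) (sphere 0 1) ∧ ∀ t, γ t = map 2 e (c t)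

/-- The attaching map of `e`, from a suitable base point and in a suitable direction, literally
traverses the oriented 1-cells of the list `l`. -/
def IsBoundaryCycle (e : cell C 2) (l : List (OrientedEdge C)) : Prop :=
  ∃ (a : X) (γ : Path a a), IsAttachingLoop C e γ ∧ IsEdgePath C l γ

/-- Two paths with the same end points are homotopic in `S`, with fixed end points. -/
def HomotopicIn {a b : X} (S : Set X) (γ γ' : Path a b) : Prop :=
  ∃ H : γ.Homotopy γ', ∀ z, H z ∈ S

/-- `l` is a word of the attaching map of `e`: for a suitable base point and direction, the
attaching loop is homotopic in the 1-skeleton, relative to the base point, to the edge path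
described by `l`. -/
def IsAttachingWord [T2Space X] (e : cell C 2) (l : List (OrientedEdge C)) : Prop :=
  ∃ (a : X) (γ γ' : Path a a), IsAttachingLoop C e γ ∧ IsEdgePath C l γ' ∧
    HomotopicIn (skeleton C 1 : Set X) γ γ'

/-- Two 0-cells are joined by a sequence of 1-cells in `T`. -/
def Joined (T : Set (cell C 1)) : cell C 0 → cell C 0 → Prop :=
  Relation.EqvGen (fun u v => ∃ x ∈ T, (OneSkeletonGraph C).IsLink x u v)

/-- `T` is the set of edges of a spanning tree of the 1-skeleton: the graph formed by all 0-cells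
and the 1-cells in `T` is nonempty and connected, and every edge of it is a bridge. -/
structure IsSpanningTree (T : Set (cell C 1)) : Prop where
  nonempty : Nonempty (cell C 0)
  connected : ∀ u v, Joined C T u v
  acyclic : ∀ x ∈ T, ∀ u v, (OneSkeletonGraph C).IsLink x u v → ¬ Joined C (T \ {x}) u v

open Classical in
/-- The letter that an oriented 1-cell contributes to a relator, once `T` is collapsed. -/
def letter (T : Set (cell C 1)) (s : OrientedEdge C) : FreeGroup ↥Tᶜ :=
  if h : s.1 ∈ T then 1
  else if s.2 then FreeGroup.of ⟨s.1, h⟩ else (FreeGroup.of ⟨s.1, h⟩)⁻¹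

/-- The presentation given by a set `T` of 1-cells to be collapsed and a word for each 2-cell. Its
generators are the 1-cells outside `T`, and there is one relator for each 2-cell. -/
def ofWords (T : Set (cell C 1)) (w : cell C 2 → List (OrientedEdge C)) :
    GroupPresentation (cell C 1) (cell C 2) where
  gens := Tᶜ
  labels := univ
  rel e := ((w e.1).map (letter C T)).prod

/-- `P` is a standard presentation of the (at most 2-dimensional) complex `C`: it is read off from
words of the attaching maps of the 2-cells, after collapsing a spanning tree. The 1-cells are
oriented by their characteristic maps. -/
def IsStandardPresentation [T2Space X] (P : GroupPresentation (cell C 1) (cell C 2)) : Prop :=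
  ∃ (T : Set (cell C 1)) (w : cell C 2 → List (OrientedEdge C)),
    IsSpanningTree C T ∧ (∀ e, IsAttachingWord C e (w e)) ∧ P = ofWords C T w

/-! ## Face poset and acyclic matchings -/

/-- A CW complex is regular if every characteristic map is a homeomorphism from the closed ball
onto the closed cell (equivalently, by compactness, injective on the closed ball). -/
def IsRegular : Prop :=
  ∀ (n : ℕ) (e : cell C n), InjOn (map n e) (closedBall 0 1)

/-- All cells of the complex. -/
abbrev Cells := Σ n : ℕ, cell C n

variable {C}

/-- The face relation. -/
def IsFace (a b : Cells C) : Prop := openCell a.1 a.2 ⊆ closedCell b.1 b.2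

/-- `a ≺ b` in the face poset. -/
def IsCovered (a b : Cells C) : Prop :=
  IsFace a b ∧ a ≠ b ∧ ∀ c, IsFace a c → IsFace c b → c = a ∨ c = b

/-- The Hasse diagram of the face poset, with the edges of `M` reversed. -/
def HasseReversed (M : Set (Cells C × Cells C)) (a b : Cells C) : Prop :=
  (IsCovered a b ∧ (a, b) ∉ M) ∨ (IsCovered b a ∧ (b, a) ∈ M)

/-- Acyclic matchings in the face poset. -/
structure IsAcyclicMatching (M : Set (Cells C × Cells C)) : Prop where
  covered : ∀ p ∈ M, IsCovered p.1 p.2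
  matching : ∀ p ∈ M, ∀ q ∈ M, ∀ a, (a = p.1 ∨ a = p.2) → (a = q.1 ∨ a = q.2) → p = q
  acyclic : ∀ a, ¬ Relation.TransGen (HasseReversed M) a a

/-- A cell is critical if it is not involved in any pair of `M`. -/
def IsCritical (M : Set (Cells C × Cells C)) (a : Cells C) : Prop :=
  ∀ p ∈ M, a ≠ p.1 ∧ a ≠ p.2

/-- The 1-cells matched with 0-cells. -/
def treeEdges (M : Set (Cells C × Cells C)) : Set (cell C 1) :=
  {x | ∃ v : cell C 0, ((⟨0, v⟩, ⟨1, x⟩) : Cells C × Cells C) ∈ M}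

/-- `l` enumerates, in some order and without repetition, the pairs of `M` that match a 1-cell with
a 2-cell. -/
def Enumerates (M : Set (Cells C × Cells C)) (l : List (cell C 1 × cell C 2)) : Prop :=
  l.Nodup ∧ ∀ x e, (x, e) ∈ l ↔ ((⟨1, x⟩, ⟨2, e⟩) : Cells C × Cells C) ∈ M

/-! ## The Morse complex -/

/-- The union of the closed cells whose level satisfies `s`. -/
def levelSet (level : Cells C → ℕ) (s : Set ℕ) : Set X :=
  ⋃ a : {a : Cells C // level a ∈ s}, closedCell a.1.1 a.1.2

/-- `r` is a retraction induced by the elementary collapse from `K` to `L` that removes the cell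
`b` and a free face of it: it moves points only inside the closed cell `b`. -/
structure IsCollapseRetraction (K L : Set X) (b : Cells C) (r : X → X) : Prop where
  continuousOn : ContinuousOn r K
  mapsTo : MapsTo r K L
  eq_self : ∀ z ∈ L, r z = z
  mapsTo_cell : MapsTo r (closedCell b.1 b.2) (closedCell b.1 b.2)

/-- `MorseComplex M D`: a realization of the CW complex `D` as the Morse complex of `C` and `M`,
i.e. as the complex obtained from `C` by a sequence of internal collapses induced by `M`.

The cells of `C` are added one at a time, in the order of an injective (up to matched pairs)
integer-valued Morse function `level`, except that the two cells of a pair of `M` are added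
together. The map `toFun : C → D` is the resulting deformation. Adding a pair `(a, b)` of `M` to a
subcomplex `L` gives a subcomplex `K` that collapses elementarily to `L`; the deformation of `K` is
that of `L` preceded by the retraction `K → L`. Adding a critical cell `e` attached along `φ` to a
subcomplex `K` attaches a cell to the complex obtained so far along the composition of `φ` with the
deformation of `K`, and the deformation is extended over `e` by the characteristic map of the new
cell. Hence the cells of `D` correspond to the critical cells of `C`, their attaching maps are those
of `C` followed by the deformation, and these data determine `D`. -/
structure MorseComplex (M : Set (Cells C × Cells C)) {Y : Type*} [TopologicalSpace Y]
    (D : Set Y) [CWComplex D] where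
  /-- The order in which the cells are added. -/
  level : Cells C → ℕ
  level_lt : ∀ a b, IsFace a b → a ≠ b → (a, b) ∉ M → level a < level b
  level_eq : ∀ a b, a ≠ b → (level a = level b ↔ (a, b) ∈ M ∨ (b, a) ∈ M)
  /-- The deformation from `C` to `D`. -/
  toFun : X → Y
  continuousOn : ContinuousOn toFun C
  mapsTo : MapsTo toFun C D
  /-- The cells of `D` are the critical cells of `C`. -/
  cellEquiv : ∀ n, {e : cell C n // IsCritical M ⟨n, e⟩} ≃ cell D n
  map_critical : ∀ n (e : {e : cell C n // IsCritical M ⟨n, e⟩}), ∀ z ∈ closedBall 0 1,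
    map n (cellEquiv n e) z = toFun (map n e.1 z)
  map_collapse : ∀ a b, (a, b) ∈ M → ∃ r : X → X,
    IsCollapseRetraction (levelSet level (Iic (level b))) (levelSet level (Iio (level b))) b r ∧
    ∀ z ∈ levelSet level (Iic (level b)), toFun z = toFun (r z)

end Complexes

end MorsePresentation

end

/-!
The eliminations are controlled by a universal description of their result. Order the 1-cells by
`y < x` if the Hasse diagram with the edges of `M` reversed has a directed path from `y` to `x`;
this is a well-founded order because the matching is acyclic and the complex is finite. For a
matched pair `(x, e)` of dimensions `(1, 2)`, regularity implies that the boundary word of `e`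
contains `x` exactly once, and all its other 1-cells precede `x`. The matched relators thus form a
triangular system (`isTriangular_ofWords`), and the elimination of one pair keeps the remaining ones
triangular (`IsTriangular.eliminate`), so the procedure never gets stuck. Its result consists of the
images of the remaining relators under a homomorphism `φ` that fixes the critical 1-cells and kills
the matched relators (`ReducesTo.exists_hom`). By induction along the order there is only one such
homomorphism (`IsTriangular.hom_ext`), so the order of the pairs does not matter.

The 1-cells matched with 0-cells form a tree because the gradient flow on 0-cells ends at the
critical 0-cell, and removing the 1-cell matched with `v` separates the 0-cells whose flow line
passes through `v` from the others (`isSpanningTree_treeEdges`).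

The same uniqueness compares the result with the Morse complex `D`. Let `f` be the deformation. All
0-cells of `C` go to the single 0-cell `d` of `D`, and the 1-skeleton goes to the 1-skeleton, so `f`
induces a homomorphism `θ` from words in the 1-cells of `C` to the fundamental group at `d` of the
1-skeleton of `D`. It kills the 1-cells matched with 0-cells, which are contracted to points, and
the boundary word of each matched 2-cell, because `f` factors on that 2-cell through a retraction
and hence maps the whole disc to the 1-skeleton (`MorseComplex.edgeHom_word_of_matched`). On
critical 1-cells it agrees with the homomorphism `Ψ` that sends a 1-cell of `D` to its class. Hence
`θ = Ψ ∘ φ` under the correspondence of cells: the image of the attaching loop of a critical 2-cell,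
which is the attaching loop of the corresponding cell of `D`, is homotopic in the 1-skeleton to any
edge path spelling the rewritten relator. As `D` has one 0-cell, the empty set is a spanning tree.
-/

noncomputable section

namespace MorsePresentation

/-! ### Successive eliminations in a triangular presentation -/

namespace GroupPresentation

variable {G R : Type*}

/-- The words in the generators `A` all of whose letters lie in `s`. -/
def wordsIn (A s : Set G) : Subgroup (FreeGroup A) :=
  Subgroup.closure (FreeGroup.of '' {g | g.1 ∈ s})

/-- The pairs of `S` can be eliminated one after the other: for `(x, e)` in `S`, the generator `x`
appears exactly once in the relator with label `e`, and every other generator of this relator that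
is to be eliminated precedes `x` with respect to `lt`. -/
def IsTriangular (P : GroupPresentation G R) (lt : G → G → Prop) (S : Set (G × R)) : Prop :=
  ∀ x e, (x, e) ∈ S → ∃ (hx : x ∈ P.gens) (he : e ∈ P.labels) (w₁ w₂ : FreeGroup P.gens) (ε : ℤ),
    w₁ ∈ wordsIn P.gens {g | (∃ e', (g, e') ∈ S) → lt g x} ∧
    w₂ ∈ wordsIn P.gens {g | (∃ e', (g, e') ∈ S) → lt g x} ∧ (ε = 1 ∨ ε = -1) ∧
    P.rel ⟨e, he⟩ = w₁ * FreeGroup.of ⟨x, hx⟩ ^ ε * w₂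

variable {P : GroupPresentation G R}

lemma of_mem_wordsIn {A s : Set G} {g : A} (h : g.1 ∈ s) : FreeGroup.of g ∈ wordsIn A s :=
  Subgroup.subset_closure ⟨g, h, rfl⟩

lemma map_mem_of_mem_wordsIn {H : Type*} [Group H] {A s : Set G} (φ : FreeGroup A →* H)
    (K : Subgroup H) (hφ : ∀ g : A, g.1 ∈ s → φ (FreeGroup.of g) ∈ K) {w : FreeGroup A}
    (hw : w ∈ wordsIn A s) : φ w ∈ K := by
  have : wordsIn A s ≤ K.comap φ := by
    refine (Subgroup.closure_le _).2 ?_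
    rintro _ ⟨g, hg, rfl⟩
    exact hφ g hg
  exact this hw

open Classical in
/-- The homomorphism that replaces the generator `x` by `u` and fixes the other generators. -/
def elimHom (P : GroupPresentation G R) (x : P.gens) (u : FreeGroup ↥(P.gens \ {x.1})) :
    FreeGroup P.gens →* FreeGroup ↥(P.gens \ {x.1}) :=
  FreeGroup.lift (fun g : P.gens => if h : g.1 = x.1 then u else FreeGroup.of ⟨g.1, g.2, h⟩)

lemma elimHom_self (x : P.gens) (u : FreeGroup ↥(P.gens \ {x.1})) :
    P.elimHom x u (FreeGroup.of x) = u := by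
  simp [elimHom]

lemma elimHom_of_ne (x : P.gens) (u : FreeGroup ↥(P.gens \ {x.1})) (g : P.gens)
    (h : g.1 ≠ x.1) : P.elimHom x u (FreeGroup.of g) = FreeGroup.of ⟨g.1, g.2, h⟩ := by
  simp [elimHom, h]

lemma elimHom_incl (x : P.gens) (u w : FreeGroup ↥(P.gens \ {x.1})) :
    P.elimHom x u (P.incl x.1 w) = w := by
  have : (P.elimHom x u).comp (P.incl x.1) = MonoidHom.id _ := by
    ext g
    simpa [incl] using elimHom_of_ne x u ⟨g.1, g.2.1⟩ g.2.2
  exact DFunLike.congr_fun this w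

lemma zpow_eq_of_mul_zpow_mul_eq_one {H : Type*} [Group H] {a b u : H} {ε : ℤ}
    (hε : ε = 1 ∨ ε = -1) : a * u ^ ε * b = 1 ↔ u = (a⁻¹ * b⁻¹) ^ ε := by
  rcases hε with rfl | rfl
  · simp only [zpow_one]
    constructor
    · intro h
      rw [mul_eq_one_iff_eq_inv] at h
      rw [← h]; group
    · rintro rfl; group
  · simp only [zpow_neg, zpow_one]
    constructor
    · intro h
      rw [mul_eq_one_iff_eq_inv] at h
      rw [← h]; group
    · rintro rfl; group

lemma elimHom_rel {x : P.gens} {e : P.labels} {u : FreeGroup ↥(P.gens \ {x.1})}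
    (hu : P.IsEquivalentExpression x e u) : P.elimHom x u (P.rel e) = 1 := by
  obtain ⟨w₁, w₂, ε, hε, h, hu⟩ := hu
  rw [h, map_mul, map_mul, map_zpow, elimHom_incl, elimHom_incl, elimHom_self]
  exact (zpow_eq_of_mul_zpow_mul_eq_one hε).2 hu

lemma exists_incl_eq_of_mem_wordsIn {x : G} {s : Set G} (hx : x ∉ s) {w : FreeGroup P.gens}
    (hw : w ∈ wordsIn P.gens s) : ∃ v, P.incl x v = w :=
  map_mem_of_mem_wordsIn (MonoidHom.id _) (P.incl x).range
    (fun g hg => ⟨FreeGroup.of ⟨g.1, g.2, fun h => hx (h ▸ hg)⟩, by simp [incl]⟩) hw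

/-- Eliminating one pair of a triangular system leaves the others triangular: the letters of the
expression substituted for `x` precede `x`, hence precede every `y` whose relator contains `x`. -/
lemma IsTriangular.eliminate {lt : G → G → Prop} [IsTrans G lt] [Std.Irrefl lt]
    {S : Set (G × R)} (hP : P.IsTriangular lt S)
    (hS : ∀ p ∈ S, ∀ q ∈ S, p.1 = q.1 ∨ p.2 = q.2 → p = q)
    {x : G} {e : R} (hxe : (x, e) ∈ S) : ∃ (hx : x ∈ P.gens) (he : e ∈ P.labels) (u : _),
      P.IsEquivalentExpression ⟨x, hx⟩ ⟨e, he⟩ u ∧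
      (P.eliminate ⟨x, hx⟩ ⟨e, he⟩ u).IsTriangular lt (S \ {(x, e)}) := by
  obtain ⟨hx, he, w₁, w₂, ε, hw₁, hw₂, hε, hrel⟩ := hP x e hxe
  have hxs : x ∉ {g | (∃ e', (g, e') ∈ S) → lt g x} := fun h => irrefl_of lt x (h ⟨e, hxe⟩)
  obtain ⟨v₁, hv₁⟩ := exists_incl_eq_of_mem_wordsIn hxs hw₁
  obtain ⟨v₂, hv₂⟩ := exists_incl_eq_of_mem_wordsIn hxs hw₂
  set u := (v₁⁻¹ * v₂⁻¹) ^ ε with hu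
  have hexpr : P.IsEquivalentExpression ⟨x, hx⟩ ⟨e, he⟩ u :=
    ⟨v₁, v₂, ε, hε, by rw [hrel, hv₁, hv₂], hu⟩
  refine ⟨hx, he, u, hexpr, ?_⟩
  have key : ∀ {s : Set G} {w : FreeGroup P.gens}, x ∉ s → w ∈ wordsIn P.gens s →
      P.elimHom ⟨x, hx⟩ u w ∈ wordsIn (P.gens \ {x}) s := by
    intro s w hxs hw
    refine map_mem_of_mem_wordsIn _ _ (fun g hg => ?_) hw
    rw [elimHom_of_ne ⟨x, hx⟩ _ _ fun h => hxs ((show g.1 = x from h) ▸ hg)]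
    exact of_mem_wordsIn hg
  have huw : u ∈ wordsIn (P.gens \ {x}) {g | (∃ e', (g, e') ∈ S) → lt g x} := by
    have h₁ := key hxs hw₁
    have h₂ := key hxs hw₂
    rw [← hv₁, elimHom_incl] at h₁
    rw [← hv₂, elimHom_incl] at h₂
    exact zpow_mem (mul_mem (inv_mem h₁) (inv_mem h₂)) _
  intro y e' hye
  obtain ⟨hy, he', a, b, δ, ha, hb, hδ, hr⟩ := hP y e' hye.1
  have hyx : y ≠ x := fun h => hye.2 (hS _ hye.1 _ hxe (Or.inl h))
  have hee : e' ≠ e := fun h => hye.2 (hS _ hye.1 _ hxe (Or.inr h))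
  have key' : ∀ {w : FreeGroup P.gens}, w ∈ wordsIn P.gens {g | (∃ e', (g, e') ∈ S) → lt g y} →
      P.elimHom ⟨x, hx⟩ u w ∈ wordsIn (P.gens \ {x})
        {g | (∃ e', (g, e') ∈ S \ {(x, e)}) → lt g y} := by
    intro w hw
    refine map_mem_of_mem_wordsIn _ _ (fun g hg => ?_) hw
    by_cases hgx : g.1 = x
    · obtain rfl : g = ⟨x, hx⟩ := Subtype.ext hgx
      rw [elimHom_self]
      refine map_mem_of_mem_wordsIn (MonoidHom.id _) _ (fun h hh => of_mem_wordsIn ?_) huw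
      rintro ⟨e'', he''⟩
      exact trans_of lt (hh ⟨e'', he''.1⟩) (hg ⟨e, hxe⟩)
    · rw [elimHom_of_ne ⟨x, hx⟩ _ _ hgx]
      exact of_mem_wordsIn
        fun ⟨e'', he''⟩ => hg ⟨e'', he''.1⟩
  refine ⟨⟨hy, hyx⟩, ⟨he', hee⟩, _, _, δ, key' ha, key' hb, hδ, ?_⟩
  change P.elimHom ⟨x, hx⟩ u (P.rel ⟨e', he'⟩) = _
  rw [hr, map_mul, map_mul, map_zpow, elimHom_of_ne _ _ _ hyx]
  rfl

lemma IsTriangular.exists_reducesTo {lt : G → G → Prop} [IsTrans G lt] [Std.Irrefl lt]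
    {l : List (G × R)} (hP : P.IsTriangular lt {p | p ∈ l}) (hl : l.Nodup)
    (hS : ∀ p ∈ l, ∀ q ∈ l, p.1 = q.1 ∨ p.2 = q.2 → p = q) : ∃ Q, P.ReducesTo l Q := by
  induction l generalizing P with
  | nil => exact ⟨P, .nil P⟩
  | cons p l ih =>
    obtain ⟨x, e⟩ := p
    obtain ⟨hx, he, u, hu, h⟩ := hP.eliminate hS (x := x) (e := e) (by simp)
    have : {p | p ∈ (x, e) :: l} \ {(x, e)} = {p | p ∈ l} := by
      ext p
      have := (List.nodup_cons.1 hl).1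
      simp only [mem_sdiff, mem_ofPred_eq, List.mem_cons, mem_singleton_iff]
      grind
    rw [this] at h
    obtain ⟨Q, hQ⟩ := ih h (List.nodup_cons.1 hl).2
      fun p hp q hq => hS p (List.mem_cons_of_mem _ hp) q (List.mem_cons_of_mem _ hq)
    exact ⟨Q, .cons P Q ⟨x, hx⟩ ⟨e, he⟩ u l hu hQ⟩

/-- The result of a sequence of eliminations, described without reference to the intermediate
presentations: the relators that remain are images of the original ones under a homomorphism that
fixes the generators that remain and kills the eliminated relators. -/
lemma ReducesTo.exists_hom {l : List (G × R)} {Q : GroupPresentation G R} (h : P.ReducesTo l Q) :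
    Q.gens = P.gens \ {x | ∃ e, (x, e) ∈ l} ∧ Q.labels = P.labels \ {e | ∃ x, (x, e) ∈ l} ∧
    ∃ φ : FreeGroup P.gens →* FreeGroup Q.gens,
      (∀ g (hg : g ∈ Q.gens) (hg' : g ∈ P.gens),
        φ (FreeGroup.of ⟨g, hg'⟩) = FreeGroup.of ⟨g, hg⟩) ∧
      (∀ p ∈ l, ∃ h, φ (P.rel ⟨p.2, h⟩) = 1) ∧
      ∀ f (hf : f ∈ Q.labels) (hf' : f ∈ P.labels), Q.rel ⟨f, hf⟩ = φ (P.rel ⟨f, hf'⟩) := by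
  induction h with
  | nil P => exact ⟨by simp, by simp, MonoidHom.id _, by simp, by simp, by simp⟩
  | cons P Q x e u l hu hQ ih =>
    obtain ⟨hg, hl, φ, h₁, h₂, h₃⟩ := ih
    let φ' : FreeGroup ↥(P.gens \ {x.1}) →* FreeGroup Q.gens := φ
    refine ⟨?_, ?_, φ'.comp (P.elimHom x u), fun g hgQ hgP => ?_, fun p hp => ?_, fun f hf hf' => ?_⟩
    · rw [hg]
      ext g
      simp only [eliminate, mem_sdiff, mem_ofPred_eq, mem_singleton_iff, List.mem_cons,
        Prod.mk.injEq]
      grind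
    · rw [hl]
      ext g
      simp only [eliminate, mem_sdiff, mem_ofPred_eq, mem_singleton_iff, List.mem_cons,
        Prod.mk.injEq]
      grind
    · have hgx : g ∈ P.gens \ {x.1} := (hg.subset hgQ).1
      rw [MonoidHom.comp_apply, elimHom_of_ne x _ ⟨g, hgP⟩ hgx.2]
      exact h₁ g hgQ hgx
    · rcases List.mem_cons.1 hp with rfl | hp
      · exact ⟨e.2, by rw [MonoidHom.comp_apply, elimHom_rel hu, map_one]⟩
      · obtain ⟨h, h'⟩ := h₂ p hp
        exact ⟨h.1, h'⟩
    · exact h₃ f hf (hl.subset hf).1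

/-- A homomorphism that kills the relators of a triangular system is determined by its values on
the generators outside the system. -/
lemma IsTriangular.hom_ext {lt : G → G → Prop} {S : Set (G × R)} (hP : P.IsTriangular lt S)
    (hwf : WellFounded lt) {H : Type*} [Group H] {φ ψ : FreeGroup P.gens →* H}
    (hφ : ∀ p ∈ S, ∃ h, φ (P.rel ⟨p.2, h⟩) = 1) (hψ : ∀ p ∈ S, ∃ h, ψ (P.rel ⟨p.2, h⟩) = 1)
    (hag : ∀ g : P.gens, (¬ ∃ e, (g.1, e) ∈ S) → φ (FreeGroup.of g) = ψ (FreeGroup.of g)) :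
    φ = ψ := by
  refine FreeGroup.ext_hom _ _ fun ⟨g, hg⟩ => ?_
  induction g using hwf.induction with
  | _ x ih =>
    by_cases hx : ∃ e, (x, e) ∈ S
    · obtain ⟨e, he⟩ := hx
      obtain ⟨hx', he', w₁, w₂, ε, hw₁, hw₂, hε, hrel⟩ := hP x e he
      have key : ∀ w ∈ wordsIn P.gens {g | (∃ e', (g, e') ∈ S) → lt g x}, φ w = ψ w := by
        intro w hw
        have : wordsIn P.gens {g | (∃ e', (g, e') ∈ S) → lt g x} ≤ φ.eqLocus ψ := by
          refine (Subgroup.closure_le _).2 ?_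
          rintro _ ⟨g, hg', rfl⟩
          by_cases hgS : ∃ e, (g.1, e) ∈ S
          · exact ih g.1 (hg' hgS) g.2
          · exact hag g hgS
        exact this hw
      obtain ⟨_, h₁⟩ := hφ _ he
      obtain ⟨_, h₂⟩ := hψ _ he
      rw [hrel, map_mul, map_mul, map_zpow, zpow_eq_of_mul_zpow_mul_eq_one hε] at h₁ h₂
      rw [h₁, h₂, key _ hw₁, key _ hw₂]
    · exact hag _ hx

lemma IsTriangular.reducesTo_unique {lt : G → G → Prop} {l l' : List (G × R)}
    (hP : P.IsTriangular lt {p | p ∈ l}) (hwf : WellFounded lt) (hll : ∀ p, p ∈ l ↔ p ∈ l')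
    {Q Q' : GroupPresentation G R} (h : P.ReducesTo l Q) (h' : P.ReducesTo l' Q') : Q = Q' := by
  obtain ⟨hg, hl, φ, h₁, h₂, h₃⟩ := h.exists_hom
  obtain ⟨hg', hl', ψ, h₁', h₂', h₃'⟩ := h'.exists_hom
  simp only [← hll] at hg' hl' h₂'
  obtain ⟨gens, labels, rel⟩ := Q
  obtain ⟨gens', labels', rel'⟩ := Q'
  dsimp only at *
  obtain rfl : gens = gens' := hg.trans hg'.symm
  obtain rfl : labels = labels' := hl.trans hl'.symm
  have : φ = ψ := by
    refine hP.hom_ext hwf h₂ h₂' fun g hgl => ?_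
    have : g.1 ∈ gens := hg.symm.subset ⟨g.2, hgl⟩
    exact (h₁ g.1 this g.2).trans (h₁' g.1 this g.2).symm
  subst this
  congr 1
  funext f
  have : f.1 ∈ P.labels := (hl.subset f.2).1
  exact (h₃ f.1 f.2 this).trans (h₃' f.1 f.2 this).symm

end GroupPresentation

/-! ### Cells and faces -/

section Cells

variable {X : Type*} [TopologicalSpace X] {C : Set X} [CWComplex C]

lemma eq_of_mem_openCell {a b : Cells C} {z : X} (ha : z ∈ openCell a.1 a.2)
    (hb : z ∈ openCell b.1 b.2) : a = b := by
  by_contra h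
  exact Set.disjoint_left.1 (RelCWComplex.disjoint_openCell_of_ne (i := a.2) (j := b.2) h) ha hb

lemma exists_mem_openCell_of_mem_cellFrontier {n : ℕ} {e : cell C n} {z : X}
    (hz : z ∈ cellFrontier n e) : ∃ a : Cells C, a.1 < n ∧ z ∈ openCell a.1 a.2 := by
  obtain ⟨I, hI⟩ := cellFrontier_subset_finite_openCell n e
  have := hI hz
  simp only [mem_iUnion] at this
  obtain ⟨m, hm, j, -, hj⟩ := this
  exact ⟨⟨m, j⟩, hm, hj⟩

lemma mem_cellFrontier_or_mem_openCell {n : ℕ} {e : cell C n} {z : X} (hz : z ∈ closedCell n e) :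
    z ∈ cellFrontier n e ∨ z ∈ openCell n e := by
  rwa [← RelCWComplex.cellFrontier_union_openCell_eq_closedCell] at hz

lemma eq_or_dim_lt_of_mem {a b : Cells C} {z : X} (ha : z ∈ openCell a.1 a.2)
    (hb : z ∈ closedCell b.1 b.2) : a = b ∨ (a.1 < b.1 ∧ z ∈ cellFrontier b.1 b.2) := by
  rcases mem_cellFrontier_or_mem_openCell hb with hb | hb
  · obtain ⟨c, hc, hz⟩ := exists_mem_openCell_of_mem_cellFrontier hb
    obtain rfl := eq_of_mem_openCell ha hz
    exact Or.inr ⟨hc, hb⟩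
  · exact Or.inl (eq_of_mem_openCell ha hb)

lemma IsFace.dim_lt {a b : Cells C} (h : IsFace a b) (hab : a ≠ b) : a.1 < b.1 :=
  ((eq_or_dim_lt_of_mem (RelCWComplex.map_zero_mem_openCell a.1 a.2)
    (h (RelCWComplex.map_zero_mem_openCell a.1 a.2))).resolve_left hab).1

lemma IsFace.refl (a : Cells C) : IsFace a a := RelCWComplex.openCell_subset_closedCell a.1 a.2

lemma IsCovered.dim_lt {a b : Cells C} (h : IsCovered a b) : a.1 < b.1 := h.1.dim_lt h.2.1

lemma IsFace.isCovered {a b : Cells C} (h : IsFace a b) (hd : b.1 = a.1 + 1) : IsCovered a b := by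
  refine ⟨h, fun hab => by rw [hab] at hd; omega, fun c hac hcb => ?_⟩
  by_contra! hc
  have := hac.dim_lt hc.1.symm
  have := hcb.dim_lt hc.2
  omega

lemma isFace_of_map_mem {v : cell C 0} {b : Cells C} (h : map 0 v ![] ∈ closedCell b.1 b.2) :
    IsFace ⟨0, v⟩ b := by
  change openCell 0 v ⊆ _
  rw [RelCWComplex.openCell_zero_eq_singleton]
  exact singleton_subset_iff.2 h

lemma IsFace.map_mem {v : cell C 0} {b : Cells C} (h : IsFace ⟨0, v⟩ b) :
    map 0 v ![] ∈ closedCell b.1 b.2 :=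
  h (by rw [RelCWComplex.openCell_zero_eq_singleton]; rfl)

lemma IsFace.closedCell_subset [T2Space X] {a b : Cells C} (h : IsFace a b) :
    closedCell a.1 a.2 ⊆ closedCell b.1 b.2 := by
  rw [← RelCWComplex.closure_openCell_eq_closedCell]
  exact closure_minimal h RelCWComplex.isClosed_closedCell

lemma isLink_iff {x : cell C 1} {u v : cell C 0} :
    (OneSkeletonGraph C).IsLink x u v ↔ cellFrontier 1 x = {map 0 u ![], map 0 v ![]} :=
  OneSkeletonGraph.isLink_iff_pair x u v

lemma exists_isLink (x : cell C 1) : ∃ u v, (OneSkeletonGraph C).IsLink x u v :=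
  exists_cellFrontier_one_eq x

lemma exists_eq_of_mem_cellFrontier_one {x : cell C 1} {z : X} (hz : z ∈ cellFrontier 1 x) :
    ∃ v : cell C 0, z = map 0 v ![] := by
  obtain ⟨u, v, h⟩ := exists_isLink x
  rw [isLink_iff.1 h] at hz
  rcases hz with hz | hz
  exacts [⟨u, hz⟩, ⟨v, hz⟩]

lemma isFace_of_isLink {x : cell C 1} {u v : cell C 0} (h : (OneSkeletonGraph C).IsLink x u v) :
    IsFace (C := C) ⟨0, u⟩ ⟨1, x⟩ :=
  isFace_of_map_mem (RelCWComplex.cellFrontier_subset_closedCell 1 x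
    ((isLink_iff.1 h).symm.subset (by simp)))

lemma mem_cellFrontier_of_isFace {x : cell C 1} {v : cell C 0}
    (h : IsFace (C := C) ⟨0, v⟩ ⟨1, x⟩) : map 0 v ![] ∈ cellFrontier 1 x :=
  ((eq_or_dim_lt_of_mem (a := ⟨0, v⟩) (b := ⟨1, x⟩)
    (RelCWComplex.openCell_zero_eq_singleton (j := v) ▸ mem_singleton _)
    h.map_mem).resolve_left fun h => by simpa using congrArg Sigma.fst h).2

lemma exists_isLink_of_isFace {x : cell C 1} {v : cell C 0}
    (h : IsFace (C := C) ⟨0, v⟩ ⟨1, x⟩) : ∃ u, (OneSkeletonGraph C).IsLink x v u := by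
  obtain ⟨u, w, hl⟩ := exists_isLink x
  have := mem_cellFrontier_of_isFace h
  rw [isLink_iff.1 hl] at this
  rcases this with h | h
  · obtain rfl := RelCWComplex.injective_map_zero C h
    exact ⟨w, hl⟩
  · obtain rfl := RelCWComplex.injective_map_zero C h
    exact ⟨u, hl.symm⟩

lemma IsRegular.ne_of_isLink (hreg : IsRegular C) {x : cell C 1} {u v : cell C 0}
    (h : (OneSkeletonGraph C).IsLink x u v) : u ≠ v := by
  rintro rfl
  rw [isLink_iff, RelCWComplex.cellFrontier_one_eq, image_pair, pair_eq_singleton] at h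
  have h1 : map 1 x (-1) = map 1 x 1 :=
    (h.subset (by simp) : _ = _).trans (h.subset (by simp) : _ = _).symm
  have := hreg 1 x (by simp) (by simp) h1
  have := congrFun this 0
  norm_num at this

end Cells

/-! ### Edge paths and boundary cycles -/

section EdgePaths

variable {X : Type*} [TopologicalSpace X] {C : Set X} [CWComplex C]

lemma const_mem_closedBall (t : unitInterval) (ε : Bool) :
    (fun _ => if ε then 2 * (t : ℝ) - 1 else 1 - 2 * (t : ℝ) : Fin 1 → ℝ) ∈ closedBall 0 1 := by
  have h0 := t.2.1
  have h1 := t.2.2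
  rw [mem_closedBall_zero_iff, pi_norm_const, Real.norm_eq_abs, abs_le]
  split_ifs <;> constructor <;> linarith

lemma exists_const_eq (ε : Bool) {z : Fin 1 → ℝ} (hz : z ∈ closedBall 0 1) : ∃ t : unitInterval,
    (fun _ => if ε then 2 * (t : ℝ) - 1 else 1 - 2 * (t : ℝ) : Fin 1 → ℝ) = z := by
  have h0 := (norm_le_pi_norm z 0).trans (mem_closedBall_zero_iff.1 hz)
  rw [Real.norm_eq_abs, abs_le] at h0
  cases ε
  · refine ⟨⟨(1 - z 0) / 2, by constructor <;> linarith⟩, ?_⟩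
    ext i
    rw [Subsingleton.elim i 0]
    simp; ring
  · refine ⟨⟨(z 0 + 1) / 2, by constructor <;> linarith⟩, ?_⟩
    ext i
    rw [Subsingleton.elim i 0]
    simp; ring

/-- An edge path either is constant or runs through the closed 1-cells of its word. -/
lemma IsEdgePath.range_eq {l : List (OrientedEdge C)} {a b : X} {γ : Path a b}
    (h : IsEdgePath C l γ) : (l = [] ∧ ∀ t, γ t = a) ∨ range γ = ⋃ s ∈ l, closedCell 1 s.1 := by
  induction h with
  | const v => exact Or.inl ⟨rfl, fun t => rfl⟩
  | edge x ε γ h =>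
    right
    simp only [List.mem_singleton, iUnion_iUnion_eq_left]
    ext z
    constructor
    · rintro ⟨t, rfl⟩
      exact ⟨_, const_mem_closedBall t ε, (h t).symm⟩
    · rintro ⟨y, hy, rfl⟩
      obtain ⟨t, ht⟩ := exists_const_eq ε hy
      exact ⟨t, by rw [h t, ht]⟩
  | @append l₁ l₂ a b c γ₁ γ₂ h₁ h₂ ih₁ ih₂ =>
    rw [Path.trans_range]
    rcases ih₁ with ⟨rfl, ih₁⟩ | ih₁
    · obtain rfl : b = a := by simpa using ih₁ 1
      have hr : range γ₁ ⊆ range γ₂ := by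
        rintro _ ⟨t, rfl⟩
        exact ⟨0, by rw [ih₁, γ₂.source]⟩
      rcases ih₂ with ⟨rfl, ih₂⟩ | ih₂
      · refine Or.inl ⟨rfl, fun t => ?_⟩
        rw [Path.trans_apply]
        split_ifs
        exacts [ih₁ _, ih₂ _]
      · exact Or.inr (by rw [union_eq_self_of_subset_left hr, ih₂]; rfl)
    · rcases ih₂ with ⟨rfl, ih₂⟩ | ih₂
      · have hr : range γ₂ ⊆ range γ₁ := by
          rintro _ ⟨t, rfl⟩
          exact ⟨1, by rw [ih₂, γ₁.target]⟩
        exact Or.inr (by rw [union_eq_self_of_subset_right hr, ih₁, List.append_nil])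
      · right
        rw [ih₁, ih₂]
        ext z
        simp only [mem_union, mem_iUnion, List.mem_append, exists_prop]
        grind

lemma trans_apply_half {a b c : X} (γ₁ : Path a b) (γ₂ : Path b c) (t : unitInterval)
    (h : (t : ℝ) / 2 ∈ unitInterval) : γ₁.trans γ₂ ⟨t / 2, h⟩ = γ₁ t := by
  have := t.2.2
  rw [Path.trans_apply, dif_pos (by simp only; linarith)]
  congr 1
  ext
  simp only; ring

lemma trans_apply_half_add {a b c : X} (γ₁ : Path a b) (γ₂ : Path b c) (t : unitInterval)
    (h : ((t : ℝ) + 1) / 2 ∈ unitInterval) (ht : 0 < t) :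
    γ₁.trans γ₂ ⟨(t + 1) / 2, h⟩ = γ₂ t := by
  have : (0 : ℝ) < t := ht
  rw [Path.trans_apply, dif_neg (by simp only; linarith)]
  congr 1
  ext
  simp only; ring

lemma half_mem {t : unitInterval} : (t : ℝ) / 2 ∈ unitInterval := by
  have := t.2.1; have := t.2.2
  constructor <;> linarith

lemma half_add_mem {t : unitInterval} : ((t : ℝ) + 1) / 2 ∈ unitInterval := by
  have := t.2.1; have := t.2.2
  constructor <;> linarith

lemma half_mem_Ioo {t : unitInterval} (ht : t ∈ Ioo 0 1) :
    (⟨t / 2, half_mem⟩ : unitInterval) ∈ Ioo 0 1 := by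
  have h0 : (0 : ℝ) < t := ht.1
  have h1 : (t : ℝ) < 1 := ht.2
  exact ⟨show (0 : ℝ) < t / 2 by linarith, show (t : ℝ) / 2 < 1 by linarith⟩

lemma half_add_mem_Ioo {t : unitInterval} (ht : t ∈ Ioo 0 1) :
    (⟨(t + 1) / 2, half_add_mem⟩ : unitInterval) ∈ Ioo 0 1 := by
  have h0 : (0 : ℝ) < t := ht.1
  have h1 : (t : ℝ) < 1 := ht.2
  exact ⟨show (0 : ℝ) < (t + 1) / 2 by linarith, show ((t : ℝ) + 1) / 2 < 1 by linarith⟩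

lemma IsEdgePath.exists_eq_map_zero {l : List (OrientedEdge C)} {a b : X} {γ : Path a b}
    (h : IsEdgePath C l γ) {x : cell C 1} (hx : x ∈ l.map Prod.fst) :
    ∃ t ∈ Ioo (0 : unitInterval) 1, γ t = map 1 x 0 := by
  induction h with
  | const v => simp at hx
  | edge y ε γ h =>
    obtain rfl : x = y := by simpa using hx
    refine ⟨⟨1 / 2, by norm_num, by norm_num⟩, ?_, ?_⟩
    · constructor <;> rw [← Subtype.coe_lt_coe] <;> norm_num
    · rw [h]
      congr 1
      ext
      simp
  | append h₁ h₂ ih₁ ih₂ =>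
    rw [List.map_append, List.mem_append] at hx
    rcases hx with hx | hx
    · obtain ⟨t, ht, h⟩ := ih₁ hx
      exact ⟨_, half_mem_Ioo ht, by rw [trans_apply_half, h]⟩
    · obtain ⟨t, ht, h⟩ := ih₂ hx
      exact ⟨_, half_add_mem_Ioo ht, by rw [trans_apply_half_add _ _ _ _ ht.1, h]⟩

/-- An edge path without self-intersections passes at most once through the midpoint of each
1-cell. -/
lemma IsEdgePath.nodup {l : List (OrientedEdge C)} {a b : X} {γ : Path a b}
    (h : IsEdgePath C l γ) (hγ : InjOn γ (Ioo 0 1)) : (l.map Prod.fst).Nodup := by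
  induction h with
  | const v => simp
  | edge y ε γ h => simp
  | append h₁ h₂ ih₁ ih₂ =>
    rw [List.map_append, List.nodup_append]
    refine ⟨ih₁ fun s hs t ht hst => ?_, ih₂ fun s hs t ht hst => ?_, fun x hx y hy hxy => ?_⟩
    · have := hγ (half_mem_Ioo hs) (half_mem_Ioo ht)
        (by rw [trans_apply_half, trans_apply_half, hst])
      have := congrArg Subtype.val this
      ext; simpa using this
    · have := hγ (half_add_mem_Ioo hs) (half_add_mem_Ioo ht)
        (by rw [trans_apply_half_add _ _ _ _ hs.1, trans_apply_half_add _ _ _ _ ht.1, hst])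
      have := congrArg Subtype.val this
      ext; simpa using this
    · obtain ⟨s, hs, h⟩ := h₁.exists_eq_map_zero hx
      obtain ⟨t, ht, h'⟩ := h₂.exists_eq_map_zero (hxy ▸ hy)
      have := hγ (half_mem_Ioo hs) (half_add_mem_Ioo ht)
        (by rw [trans_apply_half, trans_apply_half_add _ _ _ _ ht.1, h, h'])
      have := congrArg Subtype.val this
      have h0 : (0 : ℝ) < t := ht.1
      have h1 : (s : ℝ) < 1 := hs.2
      simp at this
      linarith

lemma mem_of_bijOn_Iio {Z : Type*} {c : unitInterval → Z} {s : Set Z} (h01 : c 0 = c 1)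
    (hb : BijOn c (Iio 1) s) (t : unitInterval) : c t ∈ s := by
  by_cases ht : t < 1
  · exact hb.mapsTo ht
  · obtain rfl : t = 1 := le_antisymm t.2.2 (not_lt.1 ht)
    exact h01 ▸ hb.mapsTo (mem_Iio.2 zero_lt_one)

lemma IsAttachingLoop.range_eq {e : cell C 2} {a : X} {γ : Path a a}
    (h : IsAttachingLoop C e γ) : range γ = cellFrontier 2 e := by
  obtain ⟨c, hc, h01, hb, hγ⟩ := h
  have hr : range c = sphere 0 1 :=
    (range_subset_iff.2 (mem_of_bijOn_Iio h01 hb)).antisymm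
      (hb.image_eq.symm.subset.trans (image_subset_range _ _))
  have : (γ : unitInterval → X) = map 2 e ∘ c := funext hγ
  rw [this, range_comp, hr]
  rfl

lemma IsAttachingLoop.injOn (hreg : IsRegular C) {e : cell C 2} {a : X} {γ : Path a a}
    (h : IsAttachingLoop C e γ) : InjOn γ (Iio 1) := by
  obtain ⟨c, hc, h01, hb, hγ⟩ := h
  intro s hs t ht hst
  rw [hγ, hγ] at hst
  exact hb.injOn hs ht (hreg 2 e (sphere_subset_closedBall (hb.mapsTo hs))
    (sphere_subset_closedBall (hb.mapsTo ht)) hst)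

lemma IsBoundaryCycle.nodup (hreg : IsRegular C) {e : cell C 2} {l : List (OrientedEdge C)}
    (h : IsBoundaryCycle C e l) : (l.map Prod.fst).Nodup := by
  obtain ⟨a, γ, h₁, h₂⟩ := h
  exact h₂.nodup ((h₁.injOn hreg).mono fun t ht => ht.2)

lemma IsBoundaryCycle.cellFrontier_eq (hreg : IsRegular C) {e : cell C 2}
    {l : List (OrientedEdge C)} (h : IsBoundaryCycle C e l) :
    cellFrontier 2 e = ⋃ s ∈ l, closedCell 1 s.1 := by
  obtain ⟨a, γ, h₁, h₂⟩ := h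
  rw [← h₁.range_eq]
  refine h₂.range_eq.resolve_left fun ⟨_, h⟩ => ?_
  have h1 : (⟨1 / 2, by norm_num, by norm_num⟩ : unitInterval) < 1 := by
    rw [← Subtype.coe_lt_coe]; norm_num
  have := h₁.injOn hreg (zero_lt_one : (0 : unitInterval) < 1) h1 ((h _).trans (h _).symm)
  have := congrArg Subtype.val this
  norm_num at this

end EdgePaths

/-! ### Faces of a regular complex of dimension at most two -/

section Faces

variable {X : Type*} [TopologicalSpace X] {C : Set X} [CWComplex C]
  {w : cell C 2 → List (OrientedEdge C)}

/-- In a regular complex of dimension at most two, a cell that meets a closed cell is a face of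
it. -/
lemma isFace_of_mem (hreg : IsRegular C) (hdim : ∀ n, 2 < n → IsEmpty (cell C n))
    (hw : ∀ e, IsBoundaryCycle C e (w e)) {a b : Cells C} {z : X} (ha : z ∈ openCell a.1 a.2)
    (hb : z ∈ closedCell b.1 b.2) : IsFace a b := by
  obtain ⟨n, a⟩ := a
  obtain ⟨m, b⟩ := b
  rcases eq_or_dim_lt_of_mem ha hb with h | ⟨hd, hf⟩
  · exact h ▸ IsFace.refl _
  have key : n = 0 → IsFace (⟨n, a⟩ : Cells C) ⟨m, b⟩ := by
    rintro rfl
    dsimp only at ha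
    rw [RelCWComplex.openCell_zero_eq_singleton] at ha
    obtain rfl : z = _ := ha
    exact isFace_of_map_mem hb
  dsimp only at hd hf
  rcases Nat.lt_or_ge 2 m with hm | hm
  · exact ((hdim m hm).false b).elim
  by_cases hn : n = 0
  · exact key hn
  obtain rfl : n = 1 := by omega
  obtain rfl : m = 2 := by omega
  rw [(hw b).cellFrontier_eq hreg] at hf
  simp only [mem_iUnion] at hf
  obtain ⟨s, hs, hz⟩ := hf
  rcases eq_or_dim_lt_of_mem (b := ⟨1, s.1⟩) ha hz with h | h
  · obtain rfl : a = s.1 := by simpa using h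
    refine (RelCWComplex.openCell_subset_closedCell _ _).trans
      (Subset.trans ?_ (RelCWComplex.cellFrontier_subset_closedCell 2 b))
    rw [(hw b).cellFrontier_eq hreg]
    exact subset_biUnion_of_mem (u := fun s : OrientedEdge C => closedCell 1 s.1) hs
  · exact absurd h.1 (lt_irrefl _)

lemma mem_word_iff_isFace (hreg : IsRegular C) {e : cell C 2} {l : List (OrientedEdge C)}
    (h : IsBoundaryCycle C e l) {x : cell C 1} :
    x ∈ l.map Prod.fst ↔ IsFace (C := C) ⟨1, x⟩ ⟨2, e⟩ := by
  constructor
  · intro hx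
    obtain ⟨s, hs, rfl⟩ := List.mem_map.1 hx
    refine (RelCWComplex.openCell_subset_closedCell 1 s.1).trans
      (Subset.trans ?_ (RelCWComplex.cellFrontier_subset_closedCell 2 e))
    rw [h.cellFrontier_eq hreg]
    exact subset_biUnion_of_mem (u := fun s : OrientedEdge C => closedCell 1 s.1) hs
  · intro hx
    have hm := RelCWComplex.map_zero_mem_openCell 1 x
    have := ((eq_or_dim_lt_of_mem (a := ⟨1, x⟩) hm (hx hm)).resolve_left
      fun h => by simpa using congrArg Sigma.fst h).2
    dsimp only at this
    rw [h.cellFrontier_eq hreg] at this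
    simp only [mem_iUnion] at this
    obtain ⟨s, hs, hz⟩ := this
    rcases eq_or_dim_lt_of_mem (a := ⟨1, x⟩) (b := ⟨1, s.1⟩) hm hz with h | h
    · exact List.mem_map.2 ⟨s, hs, by simpa using h.symm⟩
    · exact absurd h.1 (lt_irrefl _)

/-- In a regular complex of dimension at most two, the face poset is graded by dimension. -/
lemma IsCovered.dim_eq (hreg : IsRegular C) (hdim : ∀ n, 2 < n → IsEmpty (cell C n))
    (hw : ∀ e, IsBoundaryCycle C e (w e)) {a b : Cells C} (h : IsCovered a b) :
    b.1 = a.1 + 1 := by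
  have hlt := h.dim_lt
  obtain ⟨n, a⟩ := a
  obtain ⟨m, b⟩ := b
  dsimp only at hlt ⊢
  rcases Nat.lt_or_ge 2 m with hm | hm
  · exact ((hdim m hm).false b).elim
  by_contra hne
  -- A 0-cell on the boundary of a 2-cell also lies on one of the 1-cells of the boundary word.
  obtain rfl : n = 0 := by omega
  obtain rfl : m = 2 := by omega
  have hz := RelCWComplex.map_zero_mem_openCell 0 a
  have := ((eq_or_dim_lt_of_mem (a := ⟨0, a⟩) hz (h.1 hz)).resolve_left h.2.1).2
  dsimp only at this
  rw [(hw b).cellFrontier_eq hreg] at this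
  simp only [mem_iUnion] at this
  obtain ⟨s, hs, hzs⟩ := this
  rcases h.2.2 ⟨1, s.1⟩ (isFace_of_mem hreg hdim hw (a := ⟨0, a⟩) (b := ⟨1, s.1⟩) hz hzs)
    ((mem_word_iff_isFace hreg (hw b)).1 (List.mem_map_of_mem hs)) with h | h <;>
  simpa using congrArg Sigma.fst h

end Faces

/-! ### Acyclic matchings, the spanning tree and triangularity -/

section Matching

variable {X : Type*} [TopologicalSpace X] {C : Set X} [CWComplex C]
  {M : Set (Cells C × Cells C)}

lemma IsAcyclicMatching.wellFounded [CWComplex.Finite C] (hM : IsAcyclicMatching M) :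
    WellFounded (Relation.TransGen (HasseReversed M)) := by
  have : _root_.Finite (Cells C) := RelCWComplex.finite_cells_of_finite
  have : Std.Irrefl (Relation.TransGen (HasseReversed M)) := ⟨hM.acyclic⟩
  exact Finite.wellFounded_of_trans_of_irrefl _

lemma IsAcyclicMatching.eq_of_fst (hM : IsAcyclicMatching M) {a b c : Cells C}
    (h₁ : (a, b) ∈ M) (h₂ : (a, c) ∈ M) : b = c :=
  congrArg Prod.snd (hM.matching _ h₁ _ h₂ a (Or.inl rfl) (Or.inl rfl))

lemma IsAcyclicMatching.eq_of_snd (hM : IsAcyclicMatching M) {a b c : Cells C}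
    (h₁ : (a, c) ∈ M) (h₂ : (b, c) ∈ M) : a = b :=
  congrArg Prod.fst (hM.matching _ h₁ _ h₂ c (Or.inr rfl) (Or.inr rfl))

lemma IsAcyclicMatching.not_mem_chain (hM : IsAcyclicMatching M) {a b c : Cells C}
    (h₁ : (a, b) ∈ M) (h₂ : (b, c) ∈ M) : False := by
  have : (a, b) = (b, c) := hM.matching _ h₁ _ h₂ b (Or.inr rfl) (Or.inl rfl)
  exact (hM.covered _ h₁).2.1 (congrArg Prod.fst this)

/-- A face of the larger cell of a matched pair precedes the smaller cell of the pair. -/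
lemma IsAcyclicMatching.transGen (hM : IsAcyclicMatching M) {a b c : Cells C} (h : (a, b) ∈ M)
    (hc : IsCovered c b) (hca : c ≠ a) : Relation.TransGen (HasseReversed M) c a :=
  .tail (.single (Or.inl ⟨hc, fun h' => hca (hM.eq_of_snd h' h)⟩)) (Or.inr ⟨hM.covered _ h, h⟩)

/-- The order on 1-cells in which matched 1-cells are expressed through smaller ones. -/
def edgeLT (M : Set (Cells C × Cells C)) (x y : cell C 1) : Prop :=
  Relation.TransGen (HasseReversed M) ⟨1, x⟩ ⟨1, y⟩

instance : IsTrans (cell C 1) (edgeLT M) := ⟨fun _ _ _ h h' => Relation.TransGen.trans h h'⟩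

lemma IsAcyclicMatching.irrefl_edgeLT (hM : IsAcyclicMatching M) : Std.Irrefl (edgeLT M) :=
  ⟨fun _ => hM.acyclic _⟩

lemma IsAcyclicMatching.wellFounded_edgeLT [CWComplex.Finite C] (hM : IsAcyclicMatching M) :
    WellFounded (edgeLT M) :=
  InvImage.wf (fun x : cell C 1 => (⟨1, x⟩ : Cells C)) hM.wellFounded

/-- The pairs of `M` of dimensions `(1, 2)`. -/
def matchedPairs (M : Set (Cells C × Cells C)) : Set (cell C 1 × cell C 2) :=
  {p | ((⟨1, p.1⟩, ⟨2, p.2⟩) : Cells C × Cells C) ∈ M}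

lemma Enumerates.setOf_mem_eq {l : List (cell C 1 × cell C 2)} (hl : Enumerates M l) :
    {p | p ∈ l} = matchedPairs M := by
  ext ⟨x, e⟩
  exact hl.2 x e

lemma exists_enumerates [CWComplex.Finite C] : ∃ l, Enumerates M l := by
  have : _root_.Finite (Cells C) := RelCWComplex.finite_cells_of_finite
  have hfin : (matchedPairs M).Finite := by
    refine Set.Finite.of_finite_image (f := fun p : cell C 1 × cell C 2 =>
      ((⟨1, p.1⟩, ⟨2, p.2⟩) : Cells C × Cells C)) (Set.toFinite _) ?_
    rintro ⟨a, b⟩ - ⟨c, d⟩ - h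
    simpa using h
  refine ⟨hfin.toFinset.toList, Finset.nodup_toList _, fun x e => ?_⟩
  simp [matchedPairs]

lemma IsAcyclicMatching.matchedPairs_eq (hM : IsAcyclicMatching M) :
    ∀ p ∈ matchedPairs M, ∀ q ∈ matchedPairs M, p.1 = q.1 ∨ p.2 = q.2 → p = q := by
  rintro ⟨x, e⟩ hp ⟨y, f⟩ hq (h | h)
  · obtain rfl : x = y := h
    simpa using hM.eq_of_fst hp hq
  · obtain rfl : e = f := h
    simpa using hM.eq_of_snd hp hq

/-- One step of the gradient flow on 0-cells: `v` is moved along the 1-cell matched with it. -/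
def FlowStep (M : Set (Cells C × Cells C)) (v u : cell C 0) : Prop :=
  ∃ x : cell C 1, ((⟨0, v⟩, ⟨1, x⟩) : Cells C × Cells C) ∈ M ∧ (OneSkeletonGraph C).IsLink x v u

section Critical

variable {w : cell C 2 → List (OrientedEdge C)} (hM : IsAcyclicMatching M) (hreg : IsRegular C)
  (hdim : ∀ n, 2 < n → IsEmpty (cell C n)) (hw : ∀ e, IsBoundaryCycle C e (w e))
include hM hreg hdim hw

lemma exists_mem_of_not_isCritical_zero {v : cell C 0} (hv : ¬ IsCritical M ⟨0, v⟩) :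
    ∃ x : cell C 1, ((⟨0, v⟩, ⟨1, x⟩) : Cells C × Cells C) ∈ M := by
  simp only [IsCritical, not_forall] at hv
  obtain ⟨⟨a, b⟩, hp, h⟩ := hv
  have hd := (hM.covered _ hp).dim_eq hreg hdim hw
  obtain ⟨m, b⟩ := b
  dsimp only at h hd
  by_cases ha : (⟨0, v⟩ : Cells C) = a
  · subst ha
    obtain rfl : m = 1 := hd
    exact ⟨b, hp⟩
  · have hb : (⟨0, v⟩ : Cells C) = ⟨m, b⟩ := by tauto
    have := congrArg Sigma.fst hb
    dsimp only at this
    omega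

lemma isCritical_one_iff {x : cell C 1} : IsCritical M ⟨1, x⟩ ↔
    x ∉ treeEdges M ∧ ¬ ∃ e, (x, e) ∈ matchedPairs M := by
  constructor
  · intro h
    exact ⟨fun ⟨v, hv⟩ => (h _ hv).2 rfl, fun ⟨e, he⟩ => (h _ he).1 rfl⟩
  · rintro ⟨h₁, h₂⟩ ⟨⟨n, a⟩, ⟨m, b⟩⟩ hp
    have hd := (hM.covered _ hp).dim_eq hreg hdim hw
    dsimp only at hd
    constructor
    · intro h
      cases h
      subst hd
      exact h₂ ⟨b, hp⟩
    · intro h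
      cases h
      obtain rfl : n = 0 := by omega
      exact h₁ ⟨a, hp⟩

lemma isCritical_two_iff {e : cell C 2} : IsCritical M ⟨2, e⟩ ↔
    ¬ ∃ x, (x, e) ∈ matchedPairs M := by
  constructor
  · intro h
    exact fun ⟨x, hx⟩ => (h _ hx).2 rfl
  · rintro h₂ ⟨⟨n, a⟩, ⟨m, b⟩⟩ hp
    have hd := (hM.covered _ hp).dim_eq hreg hdim hw
    dsimp only at hd
    constructor
    · intro h
      cases h
      subst hd
      exact (hdim 3 (by norm_num)).false b
    · intro h
      cases h
      obtain rfl : n = 1 := by omega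
      exact h₂ ⟨a, hp⟩

omit hdim in
/-- The boundary word of `e` contains every 1-cell at most once, and by acyclicity all its 1-cells
other than the one matched with `e` precede the latter. -/
lemma isTriangular_ofWords :
    (ofWords C (treeEdges M) w).IsTriangular (edgeLT M) (matchedPairs M) := by
  intro x e hxe
  have hxT : x ∉ treeEdges M := fun ⟨v, hv⟩ => hM.not_mem_chain hv hxe
  have hmem := (mem_word_iff_isFace hreg (hw e)).2 (hM.covered _ hxe).1
  obtain ⟨s, hs, hsx⟩ := List.mem_map.1 hmem
  obtain ⟨l₁, l₂, hl⟩ := List.append_of_mem hs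
  have hnd := (hw e).nodup hreg
  rw [hl, List.map_append, List.map_cons, hsx, List.nodup_append, List.nodup_cons] at hnd
  have key : ∀ l : List (OrientedEdge C), (∀ t ∈ l, t ∈ w e ∧ t.1 ≠ x) →
      (l.map (letter C (treeEdges M))).prod ∈ GroupPresentation.wordsIn (treeEdges M)ᶜ
        {g | (∃ e', (g, e') ∈ matchedPairs M) → edgeLT M g x} := by
    intro l hl
    refine Subgroup.list_prod_mem _ fun g hg => ?_
    obtain ⟨t, ht, rfl⟩ := List.mem_map.1 hg
    obtain ⟨htw, htx⟩ := hl t ht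
    have hlt : edgeLT M t.1 x := hM.transGen hxe (IsFace.isCovered (C := C)
      ((mem_word_iff_isFace hreg (hw e)).1 (List.mem_map_of_mem htw)) rfl) (by simpa using htx)
    unfold letter
    split_ifs with h₁ h₂
    · exact one_mem _
    · exact GroupPresentation.of_mem_wordsIn fun _ => hlt
    · exact inv_mem (GroupPresentation.of_mem_wordsIn fun _ => hlt)
  have hle : letter C (treeEdges M) s = FreeGroup.of ⟨x, hxT⟩ ^ (if s.2 then 1 else -1 : ℤ) := by
    obtain rfl : s.1 = x := hsx
    unfold letter
    rw [dif_neg hxT]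
    split_ifs <;> simp
  have hprod : ((w e).map (letter C (treeEdges M))).prod =
      (l₁.map (letter C (treeEdges M))).prod * FreeGroup.of ⟨x, hxT⟩ ^ (if s.2 then 1 else -1 : ℤ) *
        (l₂.map (letter C (treeEdges M))).prod := by
    rw [hl, List.map_append, List.map_cons, List.prod_append, List.prod_cons, hle, mul_assoc]
  refine ⟨hxT, mem_univ _, (l₁.map (letter C (treeEdges M))).prod,
    (l₂.map (letter C (treeEdges M))).prod, if s.2 then 1 else -1, key l₁ fun t ht => ⟨?_, ?_⟩,
    key l₂ fun t ht => ⟨?_, ?_⟩, by split_ifs <;> simp, ?_⟩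
  · rw [hl]; simp [ht]
  · exact hnd.2.2 _ (List.mem_map_of_mem ht) x (by simp)
  · rw [hl]; simp [ht]
  · rintro rfl
    exact hnd.2.1.1 (List.mem_map_of_mem ht)
  · exact hprod

omit hdim hw in
lemma FlowStep.transGen {u v : cell C 0} (h : FlowStep M v u) :
    Relation.TransGen (HasseReversed M) ⟨0, u⟩ ⟨0, v⟩ := by
  obtain ⟨x, hx, hl⟩ := h
  exact hM.transGen hx (IsFace.isCovered (isFace_of_isLink hl.symm) rfl)
    (by simpa using (hreg.ne_of_isLink hl).symm)

lemma exists_flowStep {v : cell C 0} (hv : ¬ IsCritical M ⟨0, v⟩) : ∃ u, FlowStep M v u := by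
  obtain ⟨x, hx⟩ := exists_mem_of_not_isCritical_zero hM hreg hdim hw hv
  obtain ⟨u, hu⟩ := exists_isLink_of_isFace (hM.covered _ hx).1
  exact ⟨u, x, hx, hu⟩

/-- To prove a property of all 0-cells, it suffices to prove it for the critical ones and to
transport it backwards along the gradient flow. -/
lemma flow_induction [CWComplex.Finite C] {p : cell C 0 → Prop}
    (hcrit : ∀ v, IsCritical M ⟨0, v⟩ → p v) (hstep : ∀ v u, FlowStep M v u → p u → p v)
    (v : cell C 0) : p v := by
  refine (InvImage.wf (fun v : cell C 0 => (⟨0, v⟩ : Cells C)) hM.wellFounded).induction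
    (C := p) v fun v ih => ?_
  by_cases hv : IsCritical M ⟨0, v⟩
  · exact hcrit v hv
  · obtain ⟨u, hu⟩ := exists_flowStep hM hreg hdim hw hv
    exact hstep v u hu (ih u (hu.transGen hM hreg))

/-- The gradient flow joins every 0-cell to the critical one. Removing the 1-cell matched with `v`
separates the 0-cells whose flow line passes through `v` from the others. -/
lemma isSpanningTree_treeEdges [CWComplex.Finite C] (hcrit : ∃! v : cell C 0, IsCritical M ⟨0, v⟩) :
    IsSpanningTree C (treeEdges M) := by
  obtain ⟨v₀, hv₀, huniq⟩ := hcrit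
  have hjoin : ∀ v, Joined C (treeEdges M) v v₀ := by
    refine flow_induction hM hreg hdim hw (fun v hv => ?_) fun v u ⟨x, hx, hl⟩ h => ?_
    · rw [huniq v hv]
      exact .refl _
    · exact .trans _ _ _ (.rel _ _ ⟨x, ⟨v, hx⟩, hl⟩) h
  refine ⟨⟨v₀⟩, fun u v => .trans _ _ _ (hjoin u) (.symm _ _ (hjoin v)), ?_⟩
  rintro x ⟨v, hv⟩
  have hend : ∀ {y : cell C 1} {c a b : cell C 0},
      ((⟨0, c⟩, ⟨1, y⟩) : Cells C × Cells C) ∈ M → (OneSkeletonGraph C).IsLink y a b →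
      c = a ∨ c = b := by
    intro y c a b hc hl
    obtain ⟨d, hd⟩ := exists_isLink_of_isFace (hM.covered _ hc).1
    exact (hd.left_eq_or_eq hl)
  have main : ∀ u, (OneSkeletonGraph C).IsLink x v u → ¬ Joined C (treeEdges M \ {x}) v u := by
    intro u hl hJ
    -- The flow leaves `a` along `y`, and `a ≠ v` since `v` is matched with `x`; so the flow line of
    -- `a` passes through `v` if and only if that of `b` does.
    have hstep : ∀ {y a b}, y ≠ x → ((⟨0, a⟩, ⟨1, y⟩) : Cells C × Cells C) ∈ M →
        (OneSkeletonGraph C).IsLink y a b →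
        (Relation.ReflTransGen (FlowStep M) a v ↔ Relation.ReflTransGen (FlowStep M) b v) := by
      intro y a b hyx hay hab
      refine ⟨fun h => ?_, fun h => .head ⟨y, hay, hab⟩ h⟩
      rcases Relation.ReflTransGen.cases_head h with rfl | ⟨c, ⟨z, hz, hzl⟩, hc⟩
      · exact absurd (by simpa using hM.eq_of_fst hay hv) hyx
      · obtain rfl : y = z := by simpa using hM.eq_of_fst hay hz
        rwa [hab.right_unique hzl]
    have hinv : ∀ a b, Joined C (treeEdges M \ {x}) a b →
        (Relation.ReflTransGen (FlowStep M) a v ↔ Relation.ReflTransGen (FlowStep M) b v) := by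
      intro a b h
      induction h with
      | rel a b h =>
        obtain ⟨y, ⟨⟨c, hc⟩, hyx⟩, hab⟩ := h
        rcases hend hc hab with rfl | rfl
        · exact hstep hyx hc hab
        · exact (hstep hyx hc hab.symm).symm
      | refl a => rfl
      | symm a b _ ih => exact ih.symm
      | trans a b c _ _ ih₁ ih₂ => exact ih₁.trans ih₂
    have hvu : Relation.ReflTransGen (HasseReversed M) ⟨0, v⟩ ⟨0, u⟩ := by
      have : ∀ a b, Relation.ReflTransGen (FlowStep M) a b →
          Relation.ReflTransGen (HasseReversed M) ⟨0, b⟩ ⟨0, a⟩ := by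
        intro a b h
        induction h with
        | refl => rfl
        | tail _ h ih => exact (h.transGen hM hreg).to_reflTransGen.trans ih
      exact this _ _ ((hinv _ _ hJ).1 .refl)
    exact hM.acyclic _ (Relation.TransGen.trans_left (FlowStep.transGen hM hreg ⟨x, hv, hl⟩) hvu)
  intro a b hab hJ
  rcases hend hv hab with rfl | rfl
  · exact main b hab hJ
  · exact main a hab.symm (.symm _ _ hJ)

end Critical

end Matching

/-! ### Classes of loops and of edge paths -/

section Loops

variable {Z : Type*} [TopologicalSpace Z] {z : Z}

/-- The class of a loop in the fundamental group. In Mathlib the product `p * q` of this group is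
`q` followed by `p`; the opposite group makes concatenation of loops correspond to the product. -/
def loopClass (p : Path z z) : (FundamentalGroup Z z)ᵐᵒᵖ :=
  MulOpposite.op (FundamentalGroup.fromPath (Path.Homotopic.Quotient.mk p))

lemma loopClass_refl : loopClass (Path.refl z) = 1 := rfl

lemma loopClass_trans (p q : Path z z) : loopClass (p.trans q) = loopClass p * loopClass q := rfl

lemma loopClass_symm (p : Path z z) : loopClass p.symm = (loopClass p)⁻¹ := rfl

lemma loopClass_eq_iff {p q : Path z z} : loopClass p = loopClass q ↔ p.Homotopic q := by
  unfold loopClass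
  rw [MulOpposite.op_inj]
  exact Path.Homotopic.Quotient.eq

/-- A loop that factors through a convex set is nullhomotopic. -/
lemma loopClass_eq_one_of_convex {Y E : Type*} [TopologicalSpace Y] [NormedAddCommGroup E]
    [NormedSpace ℝ E] {B : Set E} (hB : Convex ℝ B) {S : Set Y} {y : S} (p : Path y y) {g : E → Y}
    (hg : ContinuousOn g B) (hgS : MapsTo g B S) {c : unitInterval → E} (hc : Continuous c)
    (h01 : c 0 = c 1) (hcB : ∀ t, c t ∈ B) (hp : ∀ t, (p t : Y) = g (c t)) :
    loopClass p = 1 := by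
  rw [← loopClass_refl, loopClass_eq_iff]
  have hmem : ∀ q : unitInterval × unitInterval,
      (1 - (q.1 : ℝ)) • c q.2 + (q.1 : ℝ) • c 0 ∈ B := fun q =>
    hB (hcB _) (hcB _) (sub_nonneg.2 q.1.2.2) q.1.2.1 (by ring)
  have hy : g (c 0) = y := by rw [← hp 0, p.source]
  refine ⟨⟨⟨⟨fun q => ⟨g ((1 - (q.1 : ℝ)) • c q.2 + (q.1 : ℝ) • c 0), hgS (hmem q)⟩, ?_⟩,
    fun t => ?_, fun t => ?_⟩, fun s t ht => ?_⟩⟩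
  · exact Continuous.subtype_mk (hg.comp_continuous (by fun_prop) hmem) _
  · exact Subtype.ext (by simpa using (hp t).symm)
  · exact Subtype.ext (by simpa using hy)
  · refine Subtype.ext ?_
    rcases ht with rfl | rfl
    · simpa [← add_smul] using hy
    · simpa [← h01, ← add_smul] using hy

end Loops

section EdgeLoops

variable {X : Type*} [TopologicalSpace X] {C : Set X} [CWComplex C]
  {Y : Type*} [TopologicalSpace Y] {f : X → Y} {S : Set Y} {y : S}

/-- The map `f` sends the 1-skeleton of `C` continuously to `S` and all 0-cells to `y`. -/
structure IsEdgeMap (C : Set X) [CWComplex C] (f : X → Y) (S : Set Y) (y : S) : Prop where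
  map_zero : ∀ v : cell C 0, f (map 0 v ![]) = y
  continuousOn : ∀ x : cell C 1, ContinuousOn f (closedCell 1 x)
  mapsTo : ∀ x : cell C 1, MapsTo f (closedCell 1 x) S

lemma map_one_mem_closedCell (x : cell C 1) (t : unitInterval) (ε : Bool) :
    map 1 x (fun _ => if ε then 2 * (t : ℝ) - 1 else 1 - 2 * (t : ℝ)) ∈ closedCell 1 x :=
  mem_image_of_mem _ (const_mem_closedBall t ε)

lemma map_one_mem_cellFrontier (x : cell C 1) {t : unitInterval} (ht : t = 0 ∨ t = 1) (ε : Bool) :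
    map 1 x (fun _ => if ε then 2 * (t : ℝ) - 1 else 1 - 2 * (t : ℝ)) ∈ cellFrontier 1 x := by
  refine mem_image_of_mem _ ?_
  rw [mem_sphere_zero_iff_norm, pi_norm_const]
  rcases ht with rfl | rfl <;> cases ε <;> norm_num

lemma continuous_map_one (x : cell C 1) (ε : Bool) : Continuous fun t : unitInterval =>
    map 1 x (fun _ => if ε then 2 * (t : ℝ) - 1 else 1 - 2 * (t : ℝ)) := by
  refine (RelCWComplex.continuousOn 1 x).comp_continuous ?_ fun t => const_mem_closedBall t ε
  cases ε <;> simp only [Bool.false_eq_true, if_true, if_false] <;> fun_prop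

lemma IsEdgeMap.apply_eq (h : IsEdgeMap C f S y) (x : cell C 1) {t : unitInterval}
    (ht : t = 0 ∨ t = 1) (ε : Bool) :
    f (map 1 x (fun _ => if ε then 2 * (t : ℝ) - 1 else 1 - 2 * (t : ℝ))) = y := by
  obtain ⟨v, hv⟩ := exists_eq_of_mem_cellFrontier_one (map_one_mem_cellFrontier x ht ε)
  rw [hv, h.map_zero]

/-- The loop in `S` that is the image of an oriented 1-cell. -/
def edgeLoop (h : IsEdgeMap C f S y) (x : cell C 1) (ε : Bool) : Path y y where
  toFun t := ⟨f (map 1 x (fun _ => if ε then 2 * (t : ℝ) - 1 else 1 - 2 * (t : ℝ))),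
    h.mapsTo x (map_one_mem_closedCell x t ε)⟩
  continuous_toFun := Continuous.subtype_mk ((h.continuousOn x).comp_continuous
    (continuous_map_one x ε) fun t => map_one_mem_closedCell x t ε) _
  source' := Subtype.ext (h.apply_eq x (Or.inl rfl) ε)
  target' := Subtype.ext (h.apply_eq x (Or.inr rfl) ε)

lemma coe_edgeLoop (h : IsEdgeMap C f S y) (x : cell C 1) (ε : Bool) (t : unitInterval) :
    (edgeLoop h x ε t : Y) =
      f (map 1 x (fun _ => if ε then 2 * (t : ℝ) - 1 else 1 - 2 * (t : ℝ))) := rfl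

/-- The homomorphism sending a 1-cell to the class of its image in the fundamental group of `S`. -/
def edgeHom (h : IsEdgeMap C f S y) : FreeGroup (cell C 1) →* (FundamentalGroup S y)ᵐᵒᵖ :=
  FreeGroup.lift fun x => loopClass (edgeLoop h x true)

lemma freeGroup_mk_false {α : Type*} (x : α) :
    FreeGroup.mk [(x, false)] = (FreeGroup.of x)⁻¹ := by
  simp [FreeGroup.of, FreeGroup.inv_mk, FreeGroup.invRev]

lemma edgeHom_mk_singleton (h : IsEdgeMap C f S y) (x : cell C 1) (ε : Bool) :
    edgeHom h (FreeGroup.mk [(x, ε)]) = loopClass (edgeLoop h x ε) := by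
  cases ε
  · have h₁ : edgeLoop h x false = (edgeLoop h x true).symm := by
      ext t
      change f (map 1 x fun _ => 1 - 2 * (t : ℝ)) = f (map 1 x fun _ => 2 * (1 - (t : ℝ)) - 1)
      congr 2
      funext i
      ring
    rw [h₁, loopClass_symm, freeGroup_mk_false, map_inv]
    simp [edgeHom]
  · change edgeHom h (FreeGroup.of x) = _
    simp [edgeHom]

/-- The image of an edge path represents the image of its word. -/
lemma IsEdgePath.exists_loop (h : IsEdgeMap C f S y) {l : List (OrientedEdge C)} {a b : X}
    {γ : Path a b} (hγ : IsEdgePath C l γ) :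
    ∃ p : Path y y, (∀ t, (p t : Y) = f (γ t)) ∧ loopClass p = edgeHom h (FreeGroup.mk l) := by
  induction hγ with
  | const v => exact ⟨Path.refl y, fun t => (h.map_zero v).symm, by
      rw [loopClass_refl, ← FreeGroup.one_eq_mk, map_one]⟩
  | edge x ε γ hγ =>
    exact ⟨edgeLoop h x ε, fun t => by rw [coe_edgeLoop, hγ], (edgeHom_mk_singleton h x ε).symm⟩
  | append h₁ h₂ ih₁ ih₂ =>
    obtain ⟨p, hp, hp'⟩ := ih₁
    obtain ⟨q, hq, hq'⟩ := ih₂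
    refine ⟨p.trans q, fun t => ?_, ?_⟩
    · rw [Path.trans_apply, Path.trans_apply]
      split_ifs
      exacts [hp _, hq _]
    · rw [loopClass_trans, hp', hq', ← map_mul, FreeGroup.mul_mk]

/-- In a complex with a single 0-cell every word is the word of an edge path. -/
lemma exists_isEdgePath [Subsingleton (cell C 0)] (v : cell C 0) (l : List (OrientedEdge C)) :
    ∃ γ : Path (map 0 v ![] : X) (map 0 v ![]), IsEdgePath C l γ := by
  induction l with
  | nil => exact ⟨_, .const v⟩
  | cons s l ih =>
    obtain ⟨x, ε⟩ := s
    obtain ⟨γ, hγ⟩ := ih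
    have hend : ∀ t : unitInterval, t = 0 ∨ t = 1 →
        map 1 x (fun _ => if ε then 2 * (t : ℝ) - 1 else 1 - 2 * (t : ℝ)) = map 0 v ![] := by
      intro t ht
      obtain ⟨u, hu⟩ := exists_eq_of_mem_cellFrontier_one (map_one_mem_cellFrontier x ht ε)
      rw [hu, Subsingleton.elim u v]
    exact ⟨_, .append (.edge x ε ⟨⟨_, continuous_map_one x ε⟩, hend 0 (Or.inl rfl),
      hend 1 (Or.inr rfl)⟩ fun t => rfl) hγ⟩

/-- Deleting the letters of `T` from a word does not change its image under a homomorphism that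
is trivial on `T`. -/
lemma map_prod_letter {H : Type*} [Group H] (g : FreeGroup (cell C 1) →* H) {T : Set (cell C 1)}
    (hT : ∀ x ∈ T, g (FreeGroup.of x) = 1) (l : List (OrientedEdge C)) :
    g (FreeGroup.map Subtype.val (l.map (letter C T)).prod) = g (FreeGroup.mk l) := by
  induction l with
  | nil => simp [← FreeGroup.one_eq_mk]
  | cons s l ih =>
    have hs : g (FreeGroup.map Subtype.val (letter C T s)) = g (FreeGroup.mk [s]) := by
      obtain ⟨x, ε⟩ := s
      have h₁ : FreeGroup.mk [(x, true)] = FreeGroup.of x := rfl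
      by_cases h : x ∈ T <;> cases ε <;> simp [letter, h, h₁, freeGroup_mk_false, hT]
    rw [List.map_cons, List.prod_cons, map_mul, map_mul, ih, hs, ← map_mul, FreeGroup.mul_mk]
    rfl

end EdgeLoops

/-! ### The deformation onto the Morse complex -/

section Morse

variable {X : Type*} [TopologicalSpace X] {C : Set X} [CWComplex C]
  {M : Set (Cells C × Cells C)} {w : cell C 2 → List (OrientedEdge C)}
  {Y : Type*} [TopologicalSpace Y] {D : Set Y} [CWComplex D]

lemma MorseComplex.level_le (K : MorseComplex M D) {a b : Cells C} (h : IsFace a b) :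
    K.level a ≤ K.level b := by
  by_cases hab : a = b
  · rw [hab]
  · by_cases hm : (a, b) ∈ M
    · exact ((K.level_eq a b hab).2 (Or.inl hm)).le
    · exact (K.level_lt a b h hab hm).le

lemma closedCell_subset_levelSet {level : Cells C → ℕ} {s : Set ℕ} {a : Cells C}
    (ha : level a ∈ s) : closedCell a.1 a.2 ⊆ levelSet level s :=
  subset_iUnion_of_subset ⟨a, ha⟩ subset_rfl

/-- The cell that contains a point of the complex built so far has been added already. -/
lemma MorseComplex.level_lt_of_mem (K : MorseComplex M D) (hreg : IsRegular C)
    (hdim : ∀ n, 2 < n → IsEmpty (cell C n)) (hw : ∀ e, IsBoundaryCycle C e (w e)) {a : Cells C}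
    {z : X} (ha : z ∈ openCell a.1 a.2) {n : ℕ} (hz : z ∈ levelSet K.level (Iio n)) :
    K.level a < n := by
  simp only [levelSet, mem_iUnion] at hz
  obtain ⟨⟨c, hc⟩, hz⟩ := hz
  exact (K.level_le (isFace_of_mem hreg hdim hw ha hz)).trans_lt hc

/-- The deformation contracts a 1-cell matched with a 0-cell to its other end. -/
lemma MorseComplex.apply_eq_of_isLink (K : MorseComplex M D) (hreg : IsRegular C)
    (hdim : ∀ n, 2 < n → IsEmpty (cell C n)) (hw : ∀ e, IsBoundaryCycle C e (w e)) {x : cell C 1}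
    {v u : cell C 0} (hM : IsAcyclicMatching M)
    (hx : ((⟨0, v⟩, ⟨1, x⟩) : Cells C × Cells C) ∈ M) (hl : (OneSkeletonGraph C).IsLink x v u)
    {z : X} (hz : z ∈ closedCell 1 x) : K.toFun z = K.toFun (map 0 u ![]) := by
  obtain ⟨r, hr, hf⟩ := K.map_collapse _ _ hx
  have hz' := closedCell_subset_levelSet (level := K.level) (a := ⟨1, x⟩)
    (mem_Iic.2 le_rfl) hz
  rw [hf z hz']
  have hrz := hr.mapsTo hz'
  -- The retraction takes values in the closed 1-cell and in the complex built before, which contains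
  -- neither the open 1-cell nor `v`.
  rcases mem_cellFrontier_or_mem_openCell (hr.mapsTo_cell hz) with h | h
  · rw [isLink_iff.1 hl] at h
    rcases h with h | h
    · exfalso
      have hv := K.level_lt_of_mem hreg hdim hw (a := ⟨0, v⟩)
        (by rw [RelCWComplex.openCell_zero_eq_singleton]; exact h) hrz
      exact hv.ne ((K.level_eq _ _ (hM.covered _ hx).2.1).2 (Or.inl hx))
    · rw [mem_singleton_iff.1 h]
  · exact absurd (K.level_lt_of_mem hreg hdim hw h hrz) (lt_irrefl _)

/-- If the deformation sends the 0-cells and the 1-cells below a matched 2-cell to `S`, then it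
sends the 2-cell to `S`: it factors through a retraction to the complex built before. -/
lemma MorseComplex.mapsTo_of_matched (K : MorseComplex M D) (hreg : IsRegular C)
    (hdim : ∀ n, 2 < n → IsEmpty (cell C n)) (hw : ∀ e, IsBoundaryCycle C e (w e)) {S : Set Y}
    (hS : ∀ v : cell C 0, K.toFun (map 0 v ![]) ∈ S) {x : cell C 1} {e : cell C 2}
    (hxe : (x, e) ∈ matchedPairs M)
    (h : ∀ y : cell C 1, K.level ⟨1, y⟩ < K.level ⟨2, e⟩ → MapsTo K.toFun (closedCell 1 y) S) :
    MapsTo K.toFun (closedCell 2 e) S := by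
  obtain ⟨r, hr, hf⟩ := K.map_collapse _ _ hxe
  intro z hz
  have hz' := closedCell_subset_levelSet (level := K.level) (a := ⟨2, e⟩)
    (mem_Iic.2 le_rfl) hz
  rw [hf z hz']
  have hrz := hr.mapsTo hz'
  rcases mem_cellFrontier_or_mem_openCell (hr.mapsTo_cell hz) with h' | h'
  · obtain ⟨⟨n, a⟩, hn, ha⟩ := exists_mem_openCell_of_mem_cellFrontier h'
    have hlt := K.level_lt_of_mem hreg hdim hw ha hrz
    dsimp only at hn
    interval_cases n
    · rw [RelCWComplex.openCell_zero_eq_singleton] at ha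
      rw [mem_singleton_iff.1 ha]
      exact hS a
    · exact h a hlt (RelCWComplex.openCell_subset_closedCell _ _ ha)
  · exact absurd (K.level_lt_of_mem hreg hdim hw h' hrz) (lt_irrefl _)

lemma subsingleton_cell_zero (K : MorseComplex M D) (hcrit : ∃! v : cell C 0, IsCritical M ⟨0, v⟩) :
    Subsingleton (cell D 0) := by
  obtain ⟨v₀, hv₀, huniq⟩ := hcrit
  have : Subsingleton {v : cell C 0 // IsCritical M ⟨0, v⟩} :=
    ⟨fun a b => Subtype.ext ((huniq _ a.2).trans (huniq _ b.2).symm)⟩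
  exact (K.cellEquiv 0).symm.subsingleton

section

variable [CWComplex.Finite C] (K : MorseComplex M D) (hM : IsAcyclicMatching M)
  (hreg : IsRegular C) (hdim : ∀ n, 2 < n → IsEmpty (cell C n))
  (hw : ∀ e, IsBoundaryCycle C e (w e)) (hcrit : ∃! v : cell C 0, IsCritical M ⟨0, v⟩)
include hM hreg hdim hw hcrit

lemma MorseComplex.apply_map_zero (d : cell D 0) (v : cell C 0) :
    K.toFun (map 0 v ![]) = map 0 d ![] := by
  have := subsingleton_cell_zero K hcrit
  refine flow_induction hM hreg hdim hw (p := fun v => K.toFun (map 0 v ![]) = map 0 d ![])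
    (fun v hv => ?_) (fun v u ⟨x, hx, hl⟩ hu => ?_) v
  · rw [← K.map_critical 0 ⟨v, hv⟩ ![] (by simp [Matrix.empty_eq]), Subsingleton.elim d]
  · rw [K.apply_eq_of_isLink hreg hdim hw hM hx hl (isFace_of_isLink hl).map_mem, hu]

lemma MorseComplex.mapsTo_skeleton [T2Space X] [T2Space Y] (d : cell D 0) (x : cell C 1) :
    MapsTo K.toFun (closedCell 1 x) (skeleton D 1 : Set Y) := by
  have h0 : ∀ v : cell C 0, K.toFun (map 0 v ![]) ∈ (skeleton D 1 : Set Y) := by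
    intro v
    rw [K.apply_map_zero hM hreg hdim hw hcrit d]
    refine (CWComplex.mem_skeleton_iff).2 ⟨0, by simp, d, ?_⟩
    rw [RelCWComplex.openCell_zero_eq_singleton]
    rfl
  induction hn : K.level ⟨1, x⟩ using Nat.strong_induction_on generalizing x with
  | _ n ih =>
    subst hn
    by_cases hT : x ∈ treeEdges M
    · obtain ⟨v, hv⟩ := hT
      obtain ⟨u, hu⟩ := exists_isLink_of_isFace (hM.covered _ hv).1
      intro z hz
      rw [K.apply_eq_of_isLink hreg hdim hw hM hv hu hz]
      exact h0 u
    by_cases hE : ∃ e, (x, e) ∈ matchedPairs M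
    · obtain ⟨e, he⟩ := hE
      have hlev : K.level ⟨1, x⟩ = K.level ⟨2, e⟩ :=
        (K.level_eq _ _ (hM.covered _ he).2.1).2 (Or.inl he)
      exact (K.mapsTo_of_matched hreg hdim hw h0 he
        fun y hy => ih _ (hlev ▸ hy) y rfl).mono_left (hM.covered _ he).1.closedCell_subset
    · have hx := (isCritical_one_iff hM hreg hdim hw).2 ⟨hT, hE⟩
      rintro _ ⟨z, hz, rfl⟩
      rw [← K.map_critical 1 ⟨x, hx⟩ z hz]
      exact RelCWComplex.closedCell_subset_skeleton 1 _ (mem_image_of_mem _ hz)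

end

end Morse

/-! ### Comparison of the presentations -/

section Comparison

variable {X : Type*} [TopologicalSpace X] [T2Space X] {C : Set X} [CWComplex C]
  {M : Set (Cells C × Cells C)} {w : cell C 2 → List (OrientedEdge C)}
  {Y : Type*} [TopologicalSpace Y] [T2Space Y] {D : Set Y} [CWComplex D]

/-- A 0-cell as a point of the 1-skeleton. -/
def vertexPoint (d : cell D 0) : (skeleton D 1 : Set Y) :=
  ⟨map 0 d ![], by
    refine CWComplex.mem_skeleton_iff.2 ⟨0, by simp, d, ?_⟩
    rw [RelCWComplex.openCell_zero_eq_singleton]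
    rfl⟩

lemma isEdgeMap_id [Subsingleton (cell D 0)] (d : cell D 0) :
    IsEdgeMap D id (skeleton D 1 : Set Y) (vertexPoint d) where
  map_zero v := by rw [Subsingleton.elim v d]; rfl
  continuousOn _ := continuousOn_id
  mapsTo x _ hz := RelCWComplex.closedCell_subset_skeleton 1 x hz

omit [T2Space Y] in
lemma HomotopicIn.of_subtype {S : Set Y} {y : S} {p q : Path y y} (h : p.Homotopic q)
    {γ γ' : Path (y : Y) y} (hγ : ∀ t, γ t = p t) (hγ' : ∀ t, γ' t = q t) :
    HomotopicIn S γ γ' := by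
  obtain rfl : γ = p.map continuous_subtype_val := by ext t; exact hγ t
  obtain rfl : γ' = q.map continuous_subtype_val := by ext t; exact hγ' t
  obtain ⟨F⟩ := h
  exact ⟨F.map ⟨Subtype.val, continuous_subtype_val⟩, fun z => (F z).2⟩

section

variable [CWComplex.Finite C] (K : MorseComplex M D) (hM : IsAcyclicMatching M)
  (hreg : IsRegular C) (hdim : ∀ n, 2 < n → IsEmpty (cell C n))
  (hw : ∀ e, IsBoundaryCycle C e (w e)) (hcrit : ∃! v : cell C 0, IsCritical M ⟨0, v⟩)
include hM hreg hdim hw hcrit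

lemma MorseComplex.isEdgeMap (d : cell D 0) :
    IsEdgeMap C K.toFun (skeleton D 1 : Set Y) (vertexPoint d) where
  map_zero := K.apply_map_zero hM hreg hdim hw hcrit d
  continuousOn x := K.continuousOn.mono (RelCWComplex.closedCell_subset_complex 1 x)
  mapsTo := K.mapsTo_skeleton hM hreg hdim hw hcrit d

/-- The image of a 1-cell matched with a 0-cell is a constant loop. -/
lemma MorseComplex.edgeHom_of_mem_treeEdges (d : cell D 0) {x : cell C 1} (hx : x ∈ treeEdges M) :
    edgeHom (K.isEdgeMap hM hreg hdim hw hcrit d) (FreeGroup.of x) = 1 := by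
  obtain ⟨v, hv⟩ := hx
  obtain ⟨u, hu⟩ := exists_isLink_of_isFace (hM.covered _ hv).1
  simp only [edgeHom, FreeGroup.lift_apply_of]
  have : edgeLoop (K.isEdgeMap hM hreg hdim hw hcrit d) x true = Path.refl (vertexPoint d) := by
    ext t
    rw [coe_edgeLoop, K.apply_eq_of_isLink hreg hdim hw hM hv hu (map_one_mem_closedCell x t true),
      K.apply_map_zero hM hreg hdim hw hcrit d]
    rfl
  rw [this, loopClass_refl]

/-- The attaching loop of a 2-cell matched with a 1-cell becomes nullhomotopic: the deformation
sends the whole 2-cell to the 1-skeleton. -/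
lemma MorseComplex.edgeHom_word_of_matched (d : cell D 0) {x : cell C 1} {e : cell C 2}
    (hxe : (x, e) ∈ matchedPairs M) :
    edgeHom (K.isEdgeMap hM hreg hdim hw hcrit d) (FreeGroup.mk (w e)) = 1 := by
  obtain ⟨a, γ, ⟨c, hc, h01, hb, hγ⟩, hp⟩ := hw e
  obtain ⟨p, hp, hcl⟩ := hp.exists_loop (K.isEdgeMap hM hreg hdim hw hcrit d)
  rw [← hcl]
  have hcB : ∀ t, c t ∈ closedBall (0 : Fin 2 → ℝ) 1 := fun t =>
    sphere_subset_closedBall (mem_of_bijOn_Iio h01 hb t)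
  have hmaps : MapsTo (map 2 e) (closedBall 0 1) (closedCell 2 e) := mapsTo_image _ _
  refine loopClass_eq_one_of_convex (convex_closedBall (0 : Fin 2 → ℝ) 1) p
    (g := K.toFun ∘ map 2 e) ?_ ?_ hc h01 hcB fun t => by rw [hp, hγ]; rfl
  · exact (K.continuousOn.mono (RelCWComplex.closedCell_subset_complex 2 e)).comp
      (RelCWComplex.continuousOn 2 e) hmaps
  · exact (K.mapsTo_of_matched hreg hdim hw
      (fun v => K.apply_map_zero hM hreg hdim hw hcrit d v ▸ (vertexPoint d).2) hxe
      fun y _ => K.mapsTo_skeleton hM hreg hdim hw hcrit d y).comp hmaps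

/-- The images of the generators in the fundamental group of the 1-skeleton of the Morse complex
satisfy the eliminated relations. Hence the rewritten relator of a critical 2-cell is a word of the
attaching map of the corresponding 2-cell of the Morse complex. -/
theorem MorseComplex.exists_isStandardPresentation {l : List (cell C 1 × cell C 2)}
    (hl : Enumerates M l) {Q : GroupPresentation (cell C 1) (cell C 2)}
    (hQ : (ofWords C (treeEdges M) w).ReducesTo l Q) :
    ∃ P : GroupPresentation (cell D 1) (cell D 2), IsStandardPresentation D P ∧
      ∃ (α : Q.gens ≃ P.gens) (β : Q.labels ≃ P.labels),
        (∀ x, ∃ h : IsCritical M ⟨1, x.1⟩, (α x).1 = K.cellEquiv 1 ⟨x.1, h⟩) ∧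
        (∀ e, ∃ h : IsCritical M ⟨2, e.1⟩, (β e).1 = K.cellEquiv 2 ⟨e.1, h⟩) ∧
        Q.EqVia P α β := by
  have hsub := subsingleton_cell_zero K hcrit
  obtain ⟨v₀, hv₀, -⟩ := id hcrit
  let d := K.cellEquiv 0 ⟨v₀, hv₀⟩
  obtain ⟨hg, hlab, φ, h₁, h₂, h₃⟩ := hQ.exists_hom
  have hgens : ∀ x, x ∈ Q.gens ↔ IsCritical M ⟨1, x⟩ := by
    intro x
    rw [isCritical_one_iff hM hreg hdim hw, hg, ← hl.setOf_mem_eq]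
    rfl
  have hlabels : ∀ e, e ∈ Q.labels ↔ IsCritical M ⟨2, e⟩ := by
    intro e
    rw [isCritical_two_iff hM hreg hdim hw, hlab, ← hl.setOf_mem_eq]
    exact and_iff_right (mem_univ _)
  let eα : Q.gens ≃ cell D 1 := (Equiv.subtypeEquivRight hgens).trans (K.cellEquiv 1)
  let eβ : Q.labels ≃ cell D 2 := (Equiv.subtypeEquivRight hlabels).trans (K.cellEquiv 2)
  have hword : ∀ e' : cell D 2, ∃ l : List (OrientedEdge D),
      FreeGroup.mk l = FreeGroup.map eα (Q.rel (eβ.symm e')) := fun e' => Quot.exists_rep _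
  choose w' hw' using hword
  -- The homomorphism induced by the deformation factors through the rewriting.
  have hfac : (edgeHom (K.isEdgeMap hM hreg hdim hw hcrit d)).comp
        (FreeGroup.map (Subtype.val : ↥(treeEdges M)ᶜ → cell C 1)) =
      (edgeHom (isEdgeMap_id d)).comp ((FreeGroup.map eα).comp φ) := by
    have htri := isTriangular_ofWords hM hreg hw
    rw [← hl.setOf_mem_eq] at htri
    refine htri.hom_ext hM.wellFounded_edgeLT (fun p hp => ⟨mem_univ _, ?_⟩) (fun p hp => ?_)
      fun g hgl => ?_
    · refine (map_prod_letter (edgeHom (K.isEdgeMap hM hreg hdim hw hcrit d))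
        (fun x hx => K.edgeHom_of_mem_treeEdges hM hreg hdim hw hcrit d hx) (w p.2)).trans ?_
      exact K.edgeHom_word_of_matched hM hreg hdim hw hcrit d (hl.setOf_mem_eq.subset hp)
    · obtain ⟨h, h'⟩ := h₂ p hp
      exact ⟨h, by rw [MonoidHom.comp_apply, MonoidHom.comp_apply, h', map_one, map_one]⟩
    · have hgQ : g.1 ∈ Q.gens := hg.symm.subset ⟨g.2, hgl⟩
      have h' := h₁ g.1 hgQ g.2
      change edgeHom _ (FreeGroup.map Subtype.val (FreeGroup.of g)) =
        edgeHom _ (FreeGroup.map eα (φ (FreeGroup.of g)))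
      rw [h', FreeGroup.map.of, FreeGroup.map.of]
      simp only [edgeHom, FreeGroup.lift_apply_of]
      congr 1
      ext t
      exact (K.map_critical 1 ⟨g.1, (hgens _).1 hgQ⟩ _ (const_mem_closedBall t true)).symm
  refine ⟨ofWords D ∅ w', ⟨∅, w', ⟨⟨d⟩, fun u v => ?_, fun x hx => hx.elim⟩, fun e' => ?_, rfl⟩,
    eα.trans (Equiv.subtypeUnivEquiv (p := (· ∈ (∅ᶜ : Set (cell D 1)))) fun x => id).symm,
    eβ.trans (Equiv.Set.univ _).symm, fun x => ⟨(hgens _).1 x.2, rfl⟩,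
    fun e => ⟨(hlabels _).1 e.2, rfl⟩, fun e => ?_⟩
  · rw [Subsingleton.elim u v]
    exact .refl _
  · obtain ⟨e, rfl⟩ := eβ.surjective e'
    have he := (hlabels _).1 e.2
    obtain ⟨a, γ, ⟨c, hc, h01, hb, hγ⟩, hp⟩ := hw e.1
    obtain ⟨p, hp, hcl⟩ := hp.exists_loop (K.isEdgeMap hM hreg hdim hw hcrit d)
    obtain ⟨γ', hγ'⟩ := exists_isEdgePath d (w' (eβ e))
    obtain ⟨q, hq, hcl'⟩ := hγ'.exists_loop (isEdgeMap_id d)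
    have hpq : p.Homotopic q := by
      rw [← loopClass_eq_iff, hcl, hcl', hw', Equiv.symm_apply_apply, h₃ e.1 e.2 (mem_univ _)]
      refine (map_prod_letter (edgeHom (K.isEdgeMap hM hreg hdim hw hcrit d))
        (fun x hx => K.edgeHom_of_mem_treeEdges hM hreg hdim hw hcrit d hx) (w e.1)).symm.trans ?_
      exact DFunLike.congr_fun hfac ((ofWords C (treeEdges M) w).rel ⟨e.1, mem_univ _⟩)
    refine ⟨_, p.map continuous_subtype_val, γ', ⟨c, hc, h01, hb, fun t => ?_⟩, hγ',
      HomotopicIn.of_subtype hpq (fun t => rfl) fun t => (hq t).symm⟩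
    have hcB : c t ∈ closedBall (0 : Fin 2 → ℝ) 1 :=
      sphere_subset_closedBall (mem_of_bijOn_Iio h01 hb t)
    exact ((hp t).trans (by rw [hγ])).trans (K.map_critical 2 ⟨e.1, he⟩ _ hcB).symm
  · -- The empty tree deletes no letters.
    apply FreeGroup.map_injective Subtype.val_injective
    refine Eq.trans ?_ (map_prod_letter (MonoidHom.id _) (T := ∅) (fun x hx => hx.elim)
      (w' (eβ e))).symm
    rw [MonoidHom.id_apply, hw', Equiv.symm_apply_apply, FreeGroup.map.comp]
    rfl

end

end Comparison

end MorsePresentation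

end

open MorsePresentation in
theorem mainTheorem7 {X : Type*} [TopologicalSpace X] [T2Space X] (C : Set X) [CWComplex C]
    [CWComplex.Finite C] (hconn : IsConnected C) (hreg : IsRegular C)
    (hdim : ∀ n, 2 < n → IsEmpty (cell C n))
    (M : Set (Cells C × Cells C)) (hM : IsAcyclicMatching M)
    (hcrit : ∃! v : cell C 0, IsCritical M ⟨0, v⟩)
    (w : cell C 2 → List (OrientedEdge C)) (hw : ∀ e, IsBoundaryCycle C e (w e)) :
    IsSpanningTree C (treeEdges M) ∧
    ∃ Q : GroupPresentation (cell C 1) (cell C 2),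
      (∀ l, Enumerates M l → ∀ Q', (ofWords C (treeEdges M) w).ReducesTo l Q' ↔ Q' = Q) ∧
      ∀ {Y : Type*} [TopologicalSpace Y] [T2Space Y] (D : Set Y) [CWComplex D]
        (K : MorseComplex M D),
        ∃ P : GroupPresentation (cell D 1) (cell D 2), IsStandardPresentation D P ∧
        ∃ (α : Q.gens ≃ P.gens) (β : Q.labels ≃ P.labels),
          (∀ x, ∃ h : IsCritical M ⟨1, x.1⟩, (α x).1 = K.cellEquiv 1 ⟨x.1, h⟩) ∧
          (∀ e, ∃ h : IsCritical M ⟨2, e.1⟩, (β e).1 = K.cellEquiv 2 ⟨e.1, h⟩) ∧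
          Q.EqVia P α β := by
  have htri := isTriangular_ofWords hM hreg hw
  have hirr := hM.irrefl_edgeLT
  have hex : ∀ l, Enumerates M l → ∃ Q, (ofWords C (treeEdges M) w).ReducesTo l Q := by
    intro l hl
    rw [← hl.setOf_mem_eq] at htri
    refine htri.exists_reducesTo hl.1 fun p hp q hq => ?_
    exact hM.matchedPairs_eq p (hl.setOf_mem_eq.subset hp) q (hl.setOf_mem_eq.subset hq)
  obtain ⟨l₀, hl₀⟩ := exists_enumerates (M := M)
  obtain ⟨Q, hQ⟩ := hex l₀ hl₀
  have huniq : ∀ l, Enumerates M l → ∀ Q', (ofWords C (treeEdges M) w).ReducesTo l Q' →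
      Q' = Q := by
    intro l hl Q' hQ'
    rw [← hl.setOf_mem_eq] at htri
    exact htri.reducesTo_unique hM.wellFounded_edgeLT
      (fun p => (hl.2 p.1 p.2).trans (hl₀.2 p.1 p.2).symm) hQ' hQ
  refine ⟨isSpanningTree_treeEdges hM hreg hdim hw hcrit, Q, fun l hl Q' =>
    ⟨huniq l hl Q', ?_⟩, fun D _ K =>
    K.exists_isStandardPresentation hM hreg hdim hw hcrit hl₀ hQ⟩
  rintro rfl
  obtain ⟨Q'', hQ''⟩ := hex l hl
  exact huniq l hl Q'' hQ'' ▸ hQ''
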